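/- **Proposition.** Let $M,Q,\lambda\in\mathbb R$, put $\underline\Delta(r)=1-\lambda r^2-\frac{2M}{r}+\frac{Q^2}{r^2}$, and consider the Reissner–Nordström–(anti) de Sitter metric $$\mathrm ds^2=-\underline\Delta\,\mathrm dt^2+\frac{\mathrm dr^2}{\underline\Delta}+r^2(\mathrm d\theta^2+\sin^2\theta\,\mathrm d\phi^2)$$ on the region $r\neq0$, $\underline\Delta(r)\ne 0$, $\sin\theta\neq0$ in Boyer–Lindquist coordinates $(t,r,\theta,\phi)$, where $\phi$ is lifted to take values in $\mathbb R$. Let $c(\ell)=(t(\ell),r(\ell),\pi/2,\phi(\ell))$, defined on a nonempty open interval $I$ with affine parameter $\ell$, be an equatorial null geodesic of this metric that is non-circular ($r$ is not constant) and non-radial ($\phi$ is not constant), with energy $E=-p_t$ and angular momentum $L=p_\phi$, where $p_\mu=g_{\mu\nu}\dot c^\nu$. Then $L\ne0$ and $\ell\mapsto\phi(\ell)$ is a diffeomorphism from $I$ onto its image $J=\phi(I)$, an open subset of $\mathbb R$, so that the radial coordinate may be regarded as a function $r=r(\phi)$ on $J$. From now on a dot denotes $\mathrm d/\mathrm d\phi$.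 Suppose that $\lambda\ge -E^2/L^2$ and let $\delta=\lambda+E^2/L^2$. Then the polynomial $\delta x^4-x^2+2Mx-Q^2$ has a real root. For every real root $\bar r$ of it, let $$\gamma=4\bar r\delta,\qquad \beta=6\bar r^2\delta-1,\qquad \alpha=4\bar r^3\delta-2\bar r+2M,$$ $$g_2=\tfrac14\Big(\tfrac{\beta^2}{3}-\alpha\gamma\Big),\qquad g_3=\tfrac18\Big(\tfrac{\alpha\beta\gamma}{6}-\tfrac{\alpha^2\delta}{2}-\tfrac{\beta^3}{27}\Big),\qquad P=\frac{\alpha}{4(r-\bar r)}+\frac{\beta}{12}.$$ Every point of $J$ has a neighbourhood in which $r(\phi)\neq\bar r$, except possibly at the point itself. At every $\phi\in J$ with $r(\phi)\ne\bar r$, the function $P$ is differentiable and $$\dot P^2=4P^3-g_2P-g_3.$$ If moreover $g_2^3-27g_3^2\neq0$, then there is a lattice $\Lambda\subset\mathbb C$ with invariants $g_2(\Lambda)=g_2$ and $g_3(\Lambda)=g_3$, and for every such $\Lambda$, with Weierstrass function $\wp=\wp_\Lambda=\wp_{g_2,g_3}$, there is a constant $z_0\in\mathbb C$ such that for all $\phi\in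 J$: one has $r(\phi)=\bar r$ if and only if $\phi+z_0\in\Lambda$ (a pole of $\wp$), and if $\phi+z_0\notin\Lambda$, then $4\wp(\phi+z_0)-\beta/3\ne0$ and $$r(\phi)=\bar r+\frac{\alpha}{4\wp(\phi+z_0)-\beta/3}.$$ -/

import Mathlib

open Set Filter Topology
open scoped ContDiff

noncomputable section

namespace RNdS

/-- Points in Boyer-Lindquist coordinates `(t, r, θ, φ) = (x 0, x 1, x 2, x 3)`; the angle `φ`
is real-valued (lifted to the universal cover of the circle). -/
abbrev Coord : Type := Fin 4 → ℝ

/-- The function `1 - λ r² - 2M/r + Q²/r²`. -/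
def lapse (M Q lam r : ℝ) : ℝ := 1 - lam * r ^ 2 - 2 * M / r + Q ^ 2 / r ^ 2

/-- The Reissner-Nordström-(anti) de Sitter metric
`ds² = -Δ dt² + dr²/Δ + r² (dθ² + sin² θ dφ²)`, with `Δ = lapse M Q lam r`. -/
def metric (M Q lam : ℝ) (x : Coord) : Matrix (Fin 4) (Fin 4) ℝ :=
  Matrix.diagonal ![-lapse M Q lam (x 1), (lapse M Q lam (x 1))⁻¹,
    x 1 ^ 2, x 1 ^ 2 * Real.sin (x 2) ^ 2]

/-- The region on which the coordinate expression of the metric is regular. -/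
def domain (M Q lam : ℝ) : Set Coord :=
  {x | x 1 ≠ 0 ∧ lapse M Q lam (x 1) ≠ 0 ∧ Real.sin (x 2) ≠ 0}

/-- The partial derivative `∂ f / ∂ x^i` at `x`. -/
def partialDeriv (i : Fin 4) (f : Coord → ℝ) (x : Coord) : ℝ :=
  deriv (fun s : ℝ => f (Function.update x i s)) (x i)

/-- The Christoffel symbols `Γ^μ_{αβ}` of a metric given by its Gram matrix in coordinates. -/
def christoffel (g : Coord → Matrix (Fin 4) (Fin 4) ℝ) (x : Coord) (μ α β : Fin 4) : ℝ :=
  (1 / 2) * ∑ ν : Fin 4, (g x)⁻¹ μ ν *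
    (partialDeriv α (fun y => g y ν β) x + partialDeriv β (fun y => g y ν α) x
      - partialDeriv ν (fun y => g y α β) x)

/-- `c` is, on the open interval `I`, an affinely parametrized geodesic of the metric. -/
structure IsGeodesicOn (M Q lam : ℝ) (c : ℝ → Coord) (I : Set ℝ) : Prop where
  isOpen : IsOpen I
  ordConnected : I.OrdConnected
  mem_domain : ∀ ℓ ∈ I, c ℓ ∈ domain M Q lam
  smooth : ContDiffOn ℝ ∞ c I
  equation : ∀ ℓ ∈ I, ∀ μ : Fin 4,
    deriv (deriv c) ℓ μ + ∑ α : Fin 4, ∑ β : Fin 4,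
      christoffel (metric M Q lam) (c ℓ) μ α β * deriv c ℓ α * deriv c ℓ β = 0

/-- The conjugate momentum `p_μ = g_{μν} ċ^ν` of the curve `c` at the parameter `ℓ`. -/
def momentum (M Q lam : ℝ) (c : ℝ → Coord) (ℓ : ℝ) (μ : Fin 4) : ℝ :=
  ∑ ν : Fin 4, metric M Q lam (c ℓ) μ ν * deriv c ℓ ν

/-- The energy `E = -p_t`. -/
def energy (M Q lam : ℝ) (c : ℝ → Coord) (ℓ : ℝ) : ℝ := -momentum M Q lam c ℓ 0

/-- The angular momentum `L = p_φ`. -/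
def angularMomentum (M Q lam : ℝ) (c : ℝ → Coord) (ℓ : ℝ) : ℝ := momentum M Q lam c ℓ 3

/-- The velocity of `c` is a null vector: `g_{μν} ċ^μ ċ^ν = 0` along `I`. -/
def IsNullOn (M Q lam : ℝ) (c : ℝ → Coord) (I : Set ℝ) : Prop :=
  ∀ ℓ ∈ I, ∑ μ : Fin 4, ∑ ν : Fin 4,
    metric M Q lam (c ℓ) μ ν * deriv c ℓ μ * deriv c ℓ ν = 0

/-- The curve lies in the equatorial plane `θ = π/2`. -/
def IsEquatorialOn (c : ℝ → Coord) (I : Set ℝ) : Prop :=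
  ∀ ℓ ∈ I, c ℓ 2 = Real.pi / 2

/-- The (equatorial) curve is circular: the coordinate `r` is constant. -/
def IsCircularOn (c : ℝ → Coord) (I : Set ℝ) : Prop :=
  ∃ r₀ : ℝ, ∀ ℓ ∈ I, c ℓ 1 = r₀

/-- The (equatorial) curve is radial: the angle `φ` is constant. -/
def IsRadialOn (c : ℝ → Coord) (I : Set ℝ) : Prop :=
  ∃ φ₀ : ℝ, ∀ ℓ ∈ I, c ℓ 3 = φ₀

/-- `f` restricts to a diffeomorphism from the open set `I` onto the open set `f '' I`. -/
def IsDiffeoOntoImage (f : ℝ → ℝ) (I : Set ℝ) : Prop :=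
  ContDiffOn ℝ ∞ f I ∧ InjOn f I ∧ IsOpen (f '' I) ∧
    ContDiffOn ℝ ∞ (Function.invFunOn f I) (f '' I)

/-- The set of values of the angle `φ` along the curve. -/
def angleRange (c : ℝ → Coord) (I : Set ℝ) : Set ℝ := (fun ℓ => c ℓ 3) '' I

/-- The radial coordinate as a function of the angle, `φ ↦ r(φ)`, meaningful on `angleRange c I`
when `ℓ ↦ φ(ℓ)` is injective on `I`. -/
def polarRadius (c : ℝ → Coord) (I : Set ℝ) (φ : ℝ) : ℝ :=
  c (Function.invFunOn (fun ℓ => c ℓ 3) I φ) 1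

end RNdS

end

/-! Conservation of energy and angular momentum together with nullity give, for the radius ρ as a
function of the angle, ρ'² = f(ρ) with f(x) = δx⁴ - x² + 2Mx - Q², and also ρ'' = f'(ρ)/2, which the
geodesic equation supplies even at turning points (`exists_polar_motion`). Since f(0) = -Q² ≤ 0 and
f ≥ 0 along the orbit, f has a real root. Expanding f at a root r̄ and inverting ρ - r̄ turns the
quartic into a cubic; the shift by β/12 removes its quadratic term (`weierstrass_sq_eq`).

Comparing P directly with ℘ is awkward: P has poles where ρ = r̄, and a first order equation does
not determine its solution where the derivative vanishes. Instead u = 4(ρ - r̄)/α = 1/(P - β/12) is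
compared with v = 1/(℘ - β/12), which is analytic at lattice points (`analyticAt_invSub`). Both
satisfy the same first order equation and the same polynomial second order equation. Every initial
datum allowed by the first order equation is attained by (v, v') (`exists_invSub_eq`), so uniqueness
gives u = v(· + z) near each angle. Local phases differ by periods, hence one phase serves the whole
connected angle range (`exists_phase`).

The lattice comes from a weight 12 form whose zero τ gives ℤτ + ℤ the right ratio g₂³ : g₃²;
rescaling then adjusts the invariants themselves (`exists_invariants_eq`). -/

section LatticeExistence
open UpperHalfPlane ModularForm MatrixGroups OnePoint EisensteinSeries ModularFormClass

/-! ### Zeros of level one modular forms -/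

namespace ModularForm

/-- A level one modular form of positive weight that does not vanish at infinity has a zero in the
upper half-plane. -/
theorem exists_zero_of_qExpansion_coeff_zero_ne_zero {k : ℤ} (hk : 0 < k) (f : ModularForm 𝒮ℒ k)
    (hf : (qExpansion 1 f).coeff 0 ≠ 0) : ∃ τ : ℍ, f τ = 0 := by
  -- Without zeros, 1/f would be a modular form of weight -k, bounded at the cusps because f has a
  -- nonzero limit at infinity; but a level one form of negative weight is zero.
  by_contra! hne
  have hanal := ModularFormClass.analyticAt_cuspFunction_zero f one_pos one_mem_strictPeriods_SL
  have hper := SlashInvariantFormClass.periodic_comp_ofComplex f one_mem_strictPeriods_SL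
  rw [qExpansion_coeff_zero one_pos hanal hper,
    ← cuspFunction_apply_zero one_pos hanal hper] at hf
  have hinf : Tendsto f atImInfty (𝓝 (cuspFunction 1 f 0)) :=
    (hanal.continuousAt.tendsto.comp (qParam_tendsto_atImInfty one_pos)).congr
      fun τ ↦ SlashInvariantFormClass.eq_cuspFunction f τ one_mem_strictPeriods_SL one_ne_zero
  have hslash (γ : SL(2, ℤ)) : (fun z ↦ 1 / f z) ∣[-k] γ = fun z ↦ 1 / f z := by
    have hγ : (γ : GL (Fin 2) ℝ) ∈ 𝒮ℒ := ⟨γ, rfl⟩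
    have h1 : (⇑(ModularForm.const (Γ := 𝒮ℒ) 1)) ∣[(0 : ℤ)] γ =
        ⇑(ModularForm.const (Γ := 𝒮ℒ) 1) := by
      rw [SL_slash, SlashInvariantForm.slash_action_eqn _ _ hγ]
    have h2 : (⇑f) ∣[k] γ = ⇑f := by
      rw [SL_slash, SlashInvariantForm.slash_action_eqn _ _ hγ]
    have := div_slash_SL2 0 k γ (⇑(ModularForm.const (Γ := 𝒮ℒ) 1)) ⇑f
    rw [h1, h2, zero_sub] at this
    exact this
  let g : ModularForm 𝒮ℒ (-k) :=
    { toFun z := 1 / f z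
      slash_action_eq' := fun _ ⟨γ, hγ⟩ ↦ hγ ▸ hslash γ
      holo' := (mdifferentiable_const (c := (1 : ℂ))).div f.holo' hne
      bdd_at_cusps' {c} hc := by
        rw [Subgroup.IsArithmetic.isCusp_iff_isCusp_SL2Z] at hc
        rw [isBoundedAt_iff_forall_SL2Z hc]
        intro γ _
        rw [hslash γ, IsBoundedAtImInfty, BoundedAtFilter]
        exact (tendsto_const_nhds.div hinf hf).isBigO_one ℝ }
  have h0 := congrFun (levelOne_neg_weight_eq_zero (neg_neg_of_pos hk) g) I
  exact one_div_ne_zero (hne I) h0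

end ModularForm

/-! ### Lattices with prescribed invariants -/

namespace PeriodPair

/-- The lattice `s Λ`. -/
def scale (Λ : PeriodPair) (s : ℂ) (hs : s ≠ 0) : PeriodPair where
  ω₁ := s * Λ.ω₁
  ω₂ := s * Λ.ω₂
  indep := by
    have := Λ.indep
    rw [LinearIndependent.pair_iff] at this ⊢
    intro a b h
    refine this a b ?_
    simp only [Complex.real_smul] at h ⊢
    have : s * (a * Λ.ω₁ + b * Λ.ω₂) = 0 := by linear_combination h
    simpa [hs] using this

theorem G_eq_tsum_int (Λ : PeriodPair) (n : ℕ) :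
    Λ.G n = ∑' p : ℤ × ℤ, ((p.1 * Λ.ω₁ + p.2 * Λ.ω₂) ^ n)⁻¹ := by
  rw [G, ← Λ.latticeEquivProd.symm.toEquiv.tsum_eq]
  refine tsum_congr fun p ↦ ?_
  rw [← Λ.latticeEquiv_symm_apply]; rfl

theorem G_scale (Λ : PeriodPair) (s : ℂ) (hs : s ≠ 0) (n : ℕ) :
    (Λ.scale s hs).G n = (s ^ n)⁻¹ * Λ.G n := by
  rw [G_eq_tsum_int, G_eq_tsum_int, ← tsum_mul_left]
  refine tsum_congr fun p ↦ ?_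
  rw [← mul_inv, ← mul_pow]
  simp only [scale]
  ring_nf

/-- The lattice `ℤ τ + ℤ`. -/
def ofUpperHalfPlane (τ : ℍ) : PeriodPair where
  ω₁ := τ
  ω₂ := 1
  indep := by
    rw [LinearIndependent.pair_iff]
    intro a b h
    have him := congrArg Complex.im h
    have hre := congrArg Complex.re h
    simp only [Complex.real_smul, Complex.add_im, Complex.mul_im, Complex.ofReal_re,
      Complex.ofReal_im, Complex.zero_im, zero_mul, add_zero, mul_one] at him
    have ha : a = 0 := by
      rcases mul_eq_zero.mp him with h | h
      · exact h
      · exact absurd h τ.im_pos.ne'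
    simpa [ha] using h

/-- Sorting integer pairs by their gcd factors ζ(k) out of the lattice sum and leaves the sum over
coprime pairs, of which the normalized `E` is one half. -/
theorem G_ofUpperHalfPlane (τ : ℍ) {k : ℕ} (hk : 3 ≤ k) :
    (ofUpperHalfPlane τ).G k = 2 * riemannZeta k * E hk τ := by
  have h1 : E hk τ = (1 / 2 : ℂ) * eisensteinSeries (N := 1) 0 k τ := rfl
  rw [h1, G_eq_tsum_int, ← (finTwoArrowEquiv ℤ).tsum_eq]
  have h2 := tsum_eisSummand_eq_riemannZeta_mul_eisensteinSeries hk τ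
  rw [show 2 * riemannZeta k * (1 / 2 * eisensteinSeries (N := 1) 0 k τ) =
    riemannZeta k * eisensteinSeries (N := 1) 0 k τ by ring, ← h2]
  refine tsum_congr fun p ↦ ?_
  simp [eisSummand, ofUpperHalfPlane]

theorem _root_.riemannZeta_six : riemannZeta 6 = Real.pi ^ 6 / 945 := by
  have := riemannZeta_two_mul_nat (k := 3) (by norm_num)
  rw [bernoulli_eq_bernoulli'_of_ne_one (by norm_num)] at this
  have h6 : bernoulli' 6 = 1 / 42 := by
    rw [bernoulli'_def]
    norm_num [Finset.sum_range_succ, Nat.choose, bernoulli'_zero, bernoulli'_one, bernoulli'_two,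
      bernoulli'_three, bernoulli'_four, bernoulli'_eq_zero_of_odd (n := 5) (by decide)]
  norm_num [Nat.factorial, h6] at this
  rw [this]
  ring

theorem g₂_ofUpperHalfPlane (τ : ℍ) :
    (ofUpperHalfPlane τ).g₂ = 4 * Real.pi ^ 4 / 3 * E₄ τ := by
  rw [g₂, G_ofUpperHalfPlane τ (by norm_num : 3 ≤ 4)]
  push_cast
  rw [riemannZeta_four]
  ring

theorem g₃_ofUpperHalfPlane (τ : ℍ) :
    (ofUpperHalfPlane τ).g₃ = 8 * Real.pi ^ 6 / 27 * E₆ τ := by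
  rw [g₃, G_ofUpperHalfPlane τ (by norm_num : 3 ≤ 6)]
  push_cast
  rw [riemannZeta_six]
  ring

theorem g₂_scale (Λ : PeriodPair) (s : ℂ) (hs : s ≠ 0) :
    (Λ.scale s hs).g₂ = (s ^ 4)⁻¹ * Λ.g₂ := by
  rw [g₂, g₂, G_scale]; ring

theorem g₃_scale (Λ : PeriodPair) (s : ℂ) (hs : s ≠ 0) :
    (Λ.scale s hs).g₃ = (s ^ 6)⁻¹ * Λ.g₃ := by
  rw [g₃, g₃, G_scale]; ring

/-- Uniformization: every pair of complex numbers with nonzero discriminant is the pair of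
invariants of a lattice. -/
theorem exists_invariants_eq (a b : ℂ) (h : a ^ 3 - 27 * b ^ 2 ≠ 0) :
    ∃ Λ : PeriodPair, Λ.g₂ = a ∧ Λ.g₃ = b := by
  -- For ℤτ + ℤ one has g₂³ : 27g₃² = E₄³ : E₆², so a zero of f is a τ whose lattice has the ratio
  -- a³ : b². The constant term of f is the discriminant a³ - 27b².
  let f : ModularForm 𝒮ℒ 12 := a ^ 3 • ModularForm.mcast (by decide) (E₆.pow 2) -
    (27 * b ^ 2) • ModularForm.mcast (by decide) (E₄.pow 3)
  have hfapp (z : ℍ) : f z = a ^ 3 * E₆ z ^ 2 - 27 * b ^ 2 * E₄ z ^ 3 := rfl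
  have hfq : (qExpansion 1 f).coeff 0 = a ^ 3 - 27 * b ^ 2 := by
    have h6 : (qExpansion 1 (E₆.pow 2)).coeff 0 = 1 := by
      simp [ModularForm.qExpansion_pow one_pos one_mem_strictPeriods_SL, pow_two,
        PowerSeries.coeff_mul, -PowerSeries.coeff_zero_eq_constantCoeff,
        E_qExpansion_coeff_zero _ ⟨3, rfl⟩]
    have h4 : (qExpansion 1 (E₄.pow 3)).coeff 0 = 1 := by
      simp [ModularForm.qExpansion_pow one_pos one_mem_strictPeriods_SL, pow_succ,
        PowerSeries.coeff_mul, -PowerSeries.coeff_zero_eq_constantCoeff,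
        E_qExpansion_coeff_zero _ ⟨2, rfl⟩]
    have hsub := ModularForm.qExpansion_sub one_pos one_mem_strictPeriods_SL
      (a ^ 3 • E₆.pow 2) ((27 * b ^ 2) • E₄.pow 3)
    have hs6 := ModularForm.qExpansion_smul one_pos one_mem_strictPeriods_SL (a ^ 3) (E₆.pow 2)
    have hs4 := ModularForm.qExpansion_smul one_pos one_mem_strictPeriods_SL (27 * b ^ 2)
      (E₄.pow 3)
    rw [FunLike.coe_smul, FunLike.coe_smul] at hsub
    have hfc : ⇑f = a ^ 3 • ⇑(E₆.pow 2) - (27 * b ^ 2) • ⇑(E₄.pow 3) := by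
      simp only [f, FunLike.coe_sub, FunLike.coe_smul, coe_mcast]
    rw [hfc, hsub, hs6, hs4, map_sub, PowerSeries.coeff_smul, PowerSeries.coeff_smul, h6, h4]
    simp
  obtain ⟨τ, hτ⟩ := exists_zero_of_qExpansion_coeff_zero_ne_zero (by norm_num) f (hfq ▸ h)
  rw [hfapp] at hτ
  have hpi : (Real.pi : ℂ) ≠ 0 := by exact_mod_cast Real.pi_ne_zero
  have hΔ : E₄ τ ^ 3 - E₆ τ ^ 2 ≠ 0 := by
    have := discriminant_ne_zero τ
    rw [discriminant_eq_E₄_cube_sub_E₆_sq] at this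
    exact fun h0 ↦ this (by rw [h0, zero_div])
  set A := (ofUpperHalfPlane τ).g₂ with hA
  set B := (ofUpperHalfPlane τ).g₃ with hB
  have hAE := g₂_ofUpperHalfPlane τ
  have hBE := g₃_ofUpperHalfPlane τ
  have hrel : a ^ 3 * B ^ 2 = b ^ 2 * A ^ 3 := by
    rw [hA, hB, hAE, hBE]
    linear_combination (64 * (Real.pi : ℂ) ^ 12 / 729) * hτ
  have hdisc : A ^ 3 - 27 * B ^ 2 ≠ 0 := by
    rw [hA, hB, hAE, hBE]
    have : (64 * (Real.pi : ℂ) ^ 12 / 27) * (E₄ τ ^ 3 - E₆ τ ^ 2) ≠ 0 :=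
      mul_ne_zero (div_ne_zero (mul_ne_zero (by norm_num) (pow_ne_zero 12 hpi)) (by norm_num)) hΔ
    convert this using 1
    ring
  suffices ∃ s : ℂ, s ≠ 0 ∧ A = s ^ 4 * a ∧ B = s ^ 6 * b by
    obtain ⟨s, hs, h2, h3⟩ := this
    refine ⟨(ofUpperHalfPlane τ).scale s hs, ?_, ?_⟩
    · rw [g₂_scale, ← hA, h2, inv_mul_cancel_left₀ (pow_ne_zero 4 hs)]
    · rw [g₃_scale, ← hB, h3, inv_mul_cancel_left₀ (pow_ne_zero 6 hs)]
  by_cases ha : a = 0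
  · have hb : b ≠ 0 := by rintro rfl; exact h (by rw [ha]; ring)
    have hA0 : A = 0 := by simpa [ha, hb] using hrel
    have hB0 : B ≠ 0 := by intro hB0; exact hdisc (by rw [hA0, hB0]; ring)
    obtain ⟨s, hs⟩ := IsAlgClosed.exists_pow_nat_eq (B / b) (n := 6) (by norm_num)
    refine ⟨s, ?_, by rw [hA0, ha, mul_zero], by rw [hs, div_mul_cancel₀ _ hb]⟩
    rintro rfl
    exact div_ne_zero hB0 hb (by rw [← hs]; norm_num)
  · have hA0 : A ≠ 0 := by
      intro hA0
      have hB0 : B = 0 := by simpa [hA0, ha] using hrel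
      exact hdisc (by rw [hA0, hB0]; ring)
    obtain ⟨s, hs⟩ := IsAlgClosed.exists_pow_nat_eq (A / a) (n := 4) (by norm_num)
    have hs0 : s ≠ 0 := by
      rintro rfl
      exact div_ne_zero hA0 ha (by rw [← hs]; norm_num)
    have hAs : A = s ^ 4 * a := by rw [hs, div_mul_cancel₀ _ ha]
    have hsq : B ^ 2 = (s ^ 6 * b) ^ 2 := by
      refine mul_left_cancel₀ (pow_ne_zero 3 ha) ?_
      rw [hrel, hAs]; ring
    -- The choice of s⁴ fixes s⁶ only up to sign; passing from s to is keeps s⁴ and negates s⁶.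
    rcases sq_eq_sq_iff_eq_or_eq_neg.mp hsq with hB' | hB'
    · exact ⟨s, hs0, hAs, hB'⟩
    · refine ⟨Complex.I * s, mul_ne_zero Complex.I_ne_zero hs0, ?_, ?_⟩
      · rw [mul_pow, Complex.I_pow_four, one_mul, hAs]
      · rw [mul_pow, show Complex.I ^ 6 = -1 by
          rw [show 6 = 4 + 2 by norm_num, pow_add, Complex.I_pow_four, Complex.I_sq, one_mul], hB']
        ring

end PeriodPair
end LatticeExistence

/-- A meromorphic function on the plane with an accumulation point of zeros vanishes near every
point, up to the point itself. -/
theorem Meromorphic.eventually_eq_zero_of_frequently {f : ℂ → ℂ} (hf : Meromorphic f) {p : ℂ}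
    (h : ∃ᶠ w in 𝓝[≠] p, f w = 0) (q : ℂ) : ∀ᶠ w in 𝓝[≠] q, f w = 0 := by
  have hp : meromorphicOrderAt f p = ⊤ :=
    meromorphicOrderAt_eq_top_iff.mpr ((hf p).frequently_zero_iff_eventuallyEq_zero.mp h)
  by_contra hq
  have hq' : meromorphicOrderAt f q ≠ ⊤ := fun h ↦ hq (meromorphicOrderAt_eq_top_iff.mp h)
  exact MeromorphicOn.meromorphicOrderAt_ne_top_of_isPreconnected (U := univ)
    (fun z _ ↦ hf z) isPreconnected_univ (mem_univ q) (mem_univ p) hq' hp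

/-- Carries identities over the isolated points where their derivation would divide by zero or meet
a pole. -/
theorem ContinuousAt.eq_of_eventuallyEq_nhdsNE {f g : ℂ → ℂ} {z : ℂ} (hf : ContinuousAt f z)
    (hg : ContinuousAt g z) (h : ∀ᶠ w in 𝓝[≠] z, f w = g w) : f z = g z :=
  tendsto_nhds_unique ((hf.tendsto.mono_left nhdsWithin_le_nhds).congr' h)
    (hg.tendsto.mono_left nhdsWithin_le_nhds)

/-! ### The elliptic function 1/(℘ - a) and its differential equations -/

namespace PeriodPair

variable (Λ : PeriodPair)

theorem tendsto_weierstrassP_cobounded {l : ℂ} (hl : l ∈ Λ.lattice) :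
    Tendsto Λ.weierstrassP (𝓝[≠] l) (Bornology.cobounded ℂ) :=
  tendsto_cobounded_of_meromorphicOrderAt_neg (by rw [Λ.order_weierstrassP l hl]; decide)

theorem continuousAt_weierstrassP {z : ℂ} (hz : z ∉ Λ.lattice) :
    ContinuousAt Λ.weierstrassP z :=
  (Λ.analyticOnNhd_weierstrassP z hz).continuousAt

/-- Otherwise ℘ - a would vanish near every point, against the pole of ℘ at 0. -/
theorem not_frequently_weierstrassP_eq (z a : ℂ) :
    ¬ ∃ᶠ w in 𝓝[≠] z, Λ.weierstrassP w = a := by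
  intro h
  have hmer : Meromorphic fun w ↦ Λ.weierstrassP w - a :=
    Λ.meromorphic_weierstrassP.sub fun _ ↦ MeromorphicAt.const a _
  have h0 := hmer.eventually_eq_zero_of_frequently (h.mono fun w hw ↦ sub_eq_zero.mpr hw) 0
  have h1 : Tendsto Λ.weierstrassP (𝓝[≠] 0) (𝓝 a) :=
    tendsto_const_nhds.congr' (h0.mono fun w hw ↦ (sub_eq_zero.mp hw).symm)
  exact h1.not_tendsto (Metric.disjoint_nhds_cobounded a)
    (Λ.tendsto_weierstrassP_cobounded Λ.lattice.zero_mem)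

theorem eventually_notMem_lattice (z : ℂ) : ∀ᶠ w in 𝓝[≠] z, w ∉ Λ.lattice := by
  filter_upwards [self_mem_nhdsWithin, mem_nhdsWithin_of_mem_nhds
    (Λ.compl_lattice_sdiff_singleton_mem_nhds z)] with w hw hw' hmem
  exact hw' ⟨hmem, hw⟩

theorem eventually_weierstrassP_ne (z a : ℂ) : ∀ᶠ w in 𝓝[≠] z, Λ.weierstrassP w ≠ a :=
  not_frequently.mp (Λ.not_frequently_weierstrassP_eq z a)

/-- The translates of `℘` by `a` and `b` can agree at accumulating points only if `a - b` is a
period. -/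
theorem sub_mem_lattice_of_frequently_eq {a b p : ℂ}
    (h : ∃ᶠ w in 𝓝[≠] p, Λ.weierstrassP (w + a) = Λ.weierstrassP (w + b)) :
    a - b ∈ Λ.lattice := by
  have hshift (a : ℂ) : Meromorphic fun w ↦ Λ.weierstrassP (w + a) := fun z ↦
    (Λ.meromorphic_weierstrassP (z + a)).comp_analyticAt (f := Λ.weierstrassP)
      (g := fun w ↦ w + a) (by fun_prop)
  -- The identity is transported to -b, where the second translate has a pole while the first is
  -- continuous unless a - b is a period.
  have h0 := ((hshift a).sub (hshift b)).eventually_eq_zero_of_frequently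
    (h.mono fun w hw ↦ sub_eq_zero.mpr hw) (-b)
  by_contra hab
  have hcont : Tendsto (fun w ↦ Λ.weierstrassP (w + a)) (𝓝[≠] (-b))
      (𝓝 (Λ.weierstrassP (a - b))) := by
    have : ContinuousAt (fun w ↦ Λ.weierstrassP (w + a)) (-b) :=
      ContinuousAt.comp (f := fun w ↦ w + a) (g := Λ.weierstrassP)
        (Λ.continuousAt_weierstrassP (by rwa [neg_add_eq_sub])) (by fun_prop)
    have := this.tendsto.mono_left (nhdsWithin_le_nhds (s := {-b}ᶜ))
    rwa [neg_add_eq_sub] at this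
  have hpole : Tendsto (fun w ↦ Λ.weierstrassP (w + b)) (𝓝[≠] (-b)) (Bornology.cobounded ℂ) := by
    refine (Λ.tendsto_weierstrassP_cobounded Λ.lattice.zero_mem).comp ?_
    refine tendsto_nhdsWithin_iff.mpr ⟨?_, ?_⟩
    · have : ContinuousAt (fun w : ℂ ↦ w + b) (-b) := by fun_prop
      simpa using this.tendsto.mono_left (nhdsWithin_le_nhds (s := {-b}ᶜ))
    · filter_upwards [self_mem_nhdsWithin] with w hw h0
      exact hw (eq_neg_of_add_eq_zero_left h0)
  have heq : Tendsto (fun w ↦ Λ.weierstrassP (w + b)) (𝓝[≠] (-b))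
      (𝓝 (Λ.weierstrassP (a - b))) :=
    hcont.congr' (h0.mono fun w hw ↦ sub_eq_zero.mp hw)
  exact heq.not_tendsto (Metric.disjoint_nhds_cobounded _) hpole

open Classical in
/-- The elliptic function `1 / (℘ - a)`, with its removable singularities at the lattice points
removed. -/
noncomputable def invSub (a z : ℂ) : ℂ :=
  if z ∈ Λ.lattice then 0 else (Λ.weierstrassP z - a)⁻¹

variable {Λ}

theorem invSub_of_mem {a z : ℂ} (hz : z ∈ Λ.lattice) : Λ.invSub a z = 0 := if_pos hz

theorem invSub_of_notMem {a z : ℂ} (hz : z ∉ Λ.lattice) :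
    Λ.invSub a z = (Λ.weierstrassP z - a)⁻¹ := if_neg hz

theorem invSub_eventuallyEq {a z : ℂ} (hz : z ∉ Λ.lattice) :
    Λ.invSub a =ᶠ[𝓝 z] fun w ↦ (Λ.weierstrassP w - a)⁻¹ := by
  filter_upwards [Λ.isClosed_lattice.isOpen_compl.mem_nhds hz] with w hw
  exact invSub_of_notMem hw

/-- At a lattice point z, ℘(w) = (w - z)⁻² + h(w) with h analytic, so 1/(℘ - a) = (w - z)²/(1 + (w -
z)²(h - a)), whose denominator is 1 at z. -/
theorem analyticAt_invSub {a z : ℂ} (hz : z ∈ Λ.lattice ∨ Λ.weierstrassP z ≠ a) :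
    AnalyticAt ℂ (Λ.invSub a) z := by
  by_cases hmem : z ∈ Λ.lattice
  · have hE : AnalyticAt ℂ (Λ.weierstrassPExcept z) z := Λ.analyticAt_weierstrassPExcept z
    have hden : AnalyticAt ℂ
        (fun w ↦ 1 + (w - z) ^ 2 * (Λ.weierstrassPExcept z w - 1 / z ^ 2 - a)) z :=
      analyticAt_const.add (((analyticAt_id.sub analyticAt_const).pow 2).mul
        ((hE.sub analyticAt_const).sub analyticAt_const))
    have hnum : AnalyticAt ℂ (fun w : ℂ ↦ (w - z) ^ 2) z := by fun_prop
    refine (hnum.div hden (by simp)).congr ?_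
    filter_upwards [Λ.compl_lattice_sdiff_singleton_mem_nhds z] with w hw
    by_cases hwz : w = z
    · subst hwz
      simp [invSub_of_mem hmem]
    · have hwl : w ∉ Λ.lattice := fun h ↦ hw ⟨h, hwz⟩
      have hsub : w - z ≠ 0 := sub_ne_zero.mpr hwz
      rw [invSub_of_notMem hwl, ← Λ.weierstrassPExcept_add ⟨z, hmem⟩]
      have : (1 + (w - z) ^ 2 * (Λ.weierstrassPExcept z w - 1 / z ^ 2 - a)) = (w - z) ^ 2 *
          (Λ.weierstrassPExcept z w + (1 / (w - z) ^ 2 - 1 / z ^ 2) - a) := by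
        field_simp
        ring
      rw [Pi.div_apply, this, div_mul_eq_div_div, div_self (pow_ne_zero 2 hsub), one_div]
  · have h := Λ.analyticOnNhd_weierstrassP z hmem
    exact ((h.sub analyticAt_const).inv (sub_ne_zero.mpr (hz.resolve_left hmem))).congr
      (invSub_eventuallyEq hmem).symm

theorem invSub_add_of_mem {a z l : ℂ} (hl : l ∈ Λ.lattice) :
    Λ.invSub a (z + l) = Λ.invSub a z := by
  by_cases hz : z ∈ Λ.lattice
  · rw [invSub_of_mem hz, invSub_of_mem (add_mem hz hl)]
  · rw [invSub_of_notMem hz, invSub_of_notMem fun h ↦ hz (by simpa using sub_mem h hl),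
      show z + l = z + (⟨l, hl⟩ : Λ.lattice) from rfl, Λ.weierstrassP_add_coe]

theorem invSub_neg (a z : ℂ) : Λ.invSub a (-z) = Λ.invSub a z := by
  by_cases hz : z ∈ Λ.lattice
  · rw [invSub_of_mem hz, invSub_of_mem (neg_mem hz)]
  · rw [invSub_of_notMem hz, invSub_of_notMem (neg_mem_iff.not.mpr hz), Λ.weierstrassP_neg]

theorem deriv_invSub_neg (a z : ℂ) : deriv (Λ.invSub a) (-z) = -deriv (Λ.invSub a) z := by
  have h := deriv_comp_neg (Λ.invSub a) z
  simp only [invSub_neg] at h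
  rw [h, neg_neg]

variable (Λ) in
/-- The Weierstrass `℘`-function takes every complex value. -/
theorem exists_weierstrassP_eq (a : ℂ) : ∃ z, z ∉ Λ.lattice ∧ Λ.weierstrassP z = a := by
  -- If a were omitted, 1/(℘ - a) would be entire and periodic, hence bounded and, by Liouville,
  -- constant; but it is 0 at lattice points and nonzero at ω₁/2.
  by_contra! hne
  have hdiff : Differentiable ℂ (Λ.invSub a) := fun z ↦
    (analyticAt_invSub (by by_cases hz : z ∈ Λ.lattice <;> simp [hz, hne])).differentiableAt
  have hbdd := (IsZLattice.isCompact_range_of_periodic Λ.lattice _ hdiff.continuous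
    fun z l hl ↦ invSub_add_of_mem hl).isBounded
  have hz := Λ.ω₁_div_two_notMem_lattice
  have h := hdiff.apply_eq_apply_of_bounded hbdd (Λ.ω₁ / 2) 0
  rw [invSub_of_mem Λ.lattice.zero_mem, invSub_of_notMem hz, inv_eq_zero, sub_eq_zero] at h
  exact hne _ hz h

theorem hasDerivAt_invSub {a z : ℂ} (hz : z ∉ Λ.lattice) (ha : Λ.weierstrassP z ≠ a) :
    HasDerivAt (Λ.invSub a) (-Λ.derivWeierstrassP z / (Λ.weierstrassP z - a) ^ 2) z := by
  have h := (Λ.analyticOnNhd_weierstrassP z hz).differentiableAt.hasDerivAt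
  rw [Λ.deriv_weierstrassP] at h
  exact ((h.sub_const a).inv (sub_ne_zero.mpr ha)).congr_of_eventuallyEq (invSub_eventuallyEq hz)

/-- With v = 1/(℘ - a), v'² = ℘'²v⁴; insert ℘ = a + 1/v into the cubic. Continuity covers the
lattice points. -/
theorem deriv_invSub_sq {a z : ℂ} (hz : AnalyticAt ℂ (Λ.invSub a) z) :
    deriv (Λ.invSub a) z ^ 2 = 4 * Λ.invSub a z + 12 * a * Λ.invSub a z ^ 2 +
      (12 * a ^ 2 - Λ.g₂) * Λ.invSub a z ^ 3 +
      (4 * a ^ 3 - Λ.g₂ * a - Λ.g₃) * Λ.invSub a z ^ 4 := by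
  have hc := hz.continuousAt
  have hd := hz.deriv.continuousAt
  refine ContinuousAt.eq_of_eventuallyEq_nhdsNE (f := fun z ↦ deriv (Λ.invSub a) z ^ 2)
    (g := fun z ↦ 4 * Λ.invSub a z + 12 * a * Λ.invSub a z ^ 2 +
      (12 * a ^ 2 - Λ.g₂) * Λ.invSub a z ^ 3 +
      (4 * a ^ 3 - Λ.g₂ * a - Λ.g₃) * Λ.invSub a z ^ 4) (by fun_prop) (by fun_prop) ?_
  filter_upwards [Λ.eventually_notMem_lattice z, Λ.eventually_weierstrassP_ne z a] with w hw hwa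
  rw [(hasDerivAt_invSub hw hwa).deriv, invSub_of_notMem hw, div_pow, neg_sq,
    Λ.derivWeierstrassP_sq w hw]
  have := sub_ne_zero.mpr hwa
  field_simp
  ring

/-- Otherwise 1/(℘ - a) is constant near z, and then so is ℘ off the lattice. -/
theorem eventually_deriv_invSub_ne_zero {a z : ℂ} (hz : AnalyticAt ℂ (Λ.invSub a) z) :
    ∀ᶠ w in 𝓝[≠] z, deriv (Λ.invSub a) w ≠ 0 := by
  refine hz.deriv.eventually_eq_zero_or_eventually_ne_zero.resolve_left fun h ↦ ?_
  have hconst : ∀ᶠ w in 𝓝 z, Λ.invSub a w = Λ.invSub a z := by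
    obtain ⟨r, hr, hball⟩ := Metric.eventually_nhds_iff_ball.mp (h.and hz.eventually_analyticAt)
    filter_upwards [Metric.ball_mem_nhds z hr] with w hw
    exact (convex_ball z r).is_const_of_fderivWithin_eq_zero (𝕜 := ℂ)
      (fun x hx ↦ (hball x hx).2.differentiableAt.differentiableWithinAt)
      (fun x hx ↦ by
        rw [fderivWithin_of_isOpen Metric.isOpen_ball hx]
        ext
        simpa using (hball x hx).1) hw (Metric.mem_ball_self hr)
  refine Λ.not_frequently_weierstrassP_eq z (a + (Λ.invSub a z)⁻¹) (Eventually.frequently ?_)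
  filter_upwards [hconst.filter_mono nhdsWithin_le_nhds, Λ.eventually_notMem_lattice z] with w h1 h2
  rw [← h1, invSub_of_notMem h2, inv_inv, add_sub_cancel]

/-- Differentiate the first order equation and cancel 2v', whose zeros are isolated. The result has
a polynomial right-hand side, so uniqueness of solutions holds even where v' = 0. -/
theorem deriv_deriv_invSub {a z : ℂ} (hz : AnalyticAt ℂ (Λ.invSub a) z) :
    deriv (deriv (Λ.invSub a)) z = 2 + 12 * a * Λ.invSub a z +
      3 / 2 * (12 * a ^ 2 - Λ.g₂) * Λ.invSub a z ^ 2 +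
      2 * (4 * a ^ 3 - Λ.g₂ * a - Λ.g₃) * Λ.invSub a z ^ 3 := by
  have hc := hz.continuousAt
  have hd := hz.deriv.deriv.continuousAt
  refine ContinuousAt.eq_of_eventuallyEq_nhdsNE (f := fun z ↦ deriv (deriv (Λ.invSub a)) z)
    (g := fun z ↦ 2 + 12 * a * Λ.invSub a z +
      3 / 2 * (12 * a ^ 2 - Λ.g₂) * Λ.invSub a z ^ 2 +
      2 * (4 * a ^ 3 - Λ.g₂ * a - Λ.g₃) * Λ.invSub a z ^ 3) (by fun_prop) (by fun_prop) ?_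
  filter_upwards [hz.eventually_analyticAt.eventually_nhds.filter_mono nhdsWithin_le_nhds,
    eventually_deriv_invSub_ne_zero hz] with w hw hw0
  have h1 := hw.self_of_nhds.differentiableAt.hasDerivAt
  have h2 := hw.self_of_nhds.deriv.differentiableAt.hasDerivAt
  have hL := h2.pow 2
  have hR := (((h1.const_mul 4).add ((h1.pow 2).const_mul (12 * a))).add
    ((h1.pow 3).const_mul (12 * a ^ 2 - Λ.g₂))).add
    ((h1.pow 4).const_mul (4 * a ^ 3 - Λ.g₂ * a - Λ.g₃))
  have heq := (hL.congr_of_eventuallyEq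
    (hw.mono fun v hv ↦ (deriv_invSub_sq hv).symm)).unique hR
  refine mul_left_cancel₀ (mul_ne_zero two_ne_zero hw0) ?_
  norm_num at heq
  linear_combination heq

end PeriodPair

/-! ### Geodesic equations and conserved quantities -/

namespace RNdS

variable {M Q lam : ℝ}

/-- The derivative of the lapse function. -/
noncomputable def lapseDeriv (M Q lam r : ℝ) : ℝ :=
  -(2 * lam * r) + 2 * M / r ^ 2 - 2 * Q ^ 2 / r ^ 3

theorem hasDerivAt_lapse {r : ℝ} (hr : r ≠ 0) :
    HasDerivAt (lapse M Q lam) (lapseDeriv M Q lam r) r := by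
  have h := (((hasDerivAt_const r (1 : ℝ)).sub ((hasDerivAt_pow 2 r).const_mul lam)).sub
    ((hasDerivAt_const r (2 * M)).div (hasDerivAt_id r) hr)).add
    ((hasDerivAt_const r (Q ^ 2)).div (hasDerivAt_pow 2 r) (pow_ne_zero 2 hr))
  refine h.congr_deriv ?_
  simp only [lapseDeriv, id]
  field_simp
  push_cast
  ring

/-- The derivative of the `ν`-th diagonal entry of the metric in the direction `α`. -/
noncomputable def metricDeriv (M Q lam : ℝ) (x : Coord) (α ν : Fin 4) : ℝ :=
  ![![0, 0, 0, 0],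
    ![-lapseDeriv M Q lam (x 1), -lapseDeriv M Q lam (x 1) / lapse M Q lam (x 1) ^ 2,
      2 * x 1, 2 * x 1 * Real.sin (x 2) ^ 2],
    ![0, 0, 0, x 1 ^ 2 * (2 * Real.sin (x 2) * Real.cos (x 2))],
    ![0, 0, 0, 0]] α ν

theorem partialDeriv_metric {x : Coord} (hx : x ∈ domain M Q lam) (α ν β : Fin 4) :
    partialDeriv α (fun y ↦ metric M Q lam y ν β) x =
      if ν = β then metricDeriv M Q lam x α ν else 0 := by
  split_ifs with h
  · subst h
    obtain ⟨hr, hΔ, -⟩ := hx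
    have hl := hasDerivAt_lapse (M := M) (Q := Q) (lam := lam) hr
    simp only [partialDeriv, metric, Matrix.diagonal_apply_eq]
    fin_cases α <;> fin_cases ν <;> simp [metricDeriv]
    · exact hl.deriv
    · exact (hl.inv hΔ).deriv
  · simp [partialDeriv, metric, Matrix.diagonal_apply_ne _ h]

theorem metric_eq_diagonal (x : Coord) :
    metric M Q lam x = Matrix.diagonal fun μ ↦ metric M Q lam x μ μ := by
  simp [metric]

theorem metric_apply_self_ne_zero {x : Coord} (hx : x ∈ domain M Q lam) (μ : Fin 4) :
    metric M Q lam x μ μ ≠ 0 := by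
  obtain ⟨hr, hΔ, hs⟩ := hx
  fin_cases μ <;> simp [metric, hr, hΔ, hs]

theorem metric_inv_apply {x : Coord} (hx : x ∈ domain M Q lam) (μ ν : Fin 4) :
    (metric M Q lam x)⁻¹ μ ν = if μ = ν then (metric M Q lam x μ μ)⁻¹ else 0 := by
  have h : (metric M Q lam x)⁻¹ = Matrix.diagonal fun μ ↦ (metric M Q lam x μ μ)⁻¹ := by
    refine Matrix.inv_eq_right_inv ?_
    rw [metric_eq_diagonal, Matrix.diagonal_mul_diagonal, ← Matrix.diagonal_one]
    congr 1
    funext μ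
    simpa using mul_inv_cancel₀ (metric_apply_self_ne_zero hx μ)
  rw [h, Matrix.diagonal_apply]

/-- As the metric is diagonal, only g^{μμ} and derivatives of diagonal entries survive, and symmetry
in α, β merges the first two terms of the Christoffel symbol. -/
theorem geodesic_sum_eq {x : Coord} (hx : x ∈ domain M Q lam) (v : Coord) (μ : Fin 4) :
    ∑ α : Fin 4, ∑ β : Fin 4, christoffel (metric M Q lam) x μ α β * v α * v β =
      (metric M Q lam x μ μ)⁻¹ * (∑ α : Fin 4, metricDeriv M Q lam x α μ * v α * v μ -
        1 / 2 * ∑ α : Fin 4, metricDeriv M Q lam x μ α * v α ^ 2) := by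
  have hΓ (α β : Fin 4) : christoffel (metric M Q lam) x μ α β =
      1 / 2 * ((metric M Q lam x μ μ)⁻¹ * ((if μ = β then metricDeriv M Q lam x α μ else 0) +
        (if μ = α then metricDeriv M Q lam x β μ else 0) -
        (if α = β then metricDeriv M Q lam x μ α else 0))) := by
    simp [christoffel, metric_inv_apply hx, partialDeriv_metric hx]
  simp only [hΓ]
  generalize (metric M Q lam x μ μ)⁻¹ = g
  generalize metricDeriv M Q lam x = d
  fin_cases μ <;> simp [Fin.sum_univ_four] <;> ring

variable {c : ℝ → Coord} {I : Set ℝ}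

namespace IsGeodesicOn

theorem contDiffAt (h : IsGeodesicOn M Q lam c I) {ℓ : ℝ} (hℓ : ℓ ∈ I) : ContDiffAt ℝ ∞ c ℓ :=
  h.smooth.contDiffAt (h.isOpen.mem_nhds hℓ)

theorem hasDerivAt_apply (h : IsGeodesicOn M Q lam c I) {ℓ : ℝ} (hℓ : ℓ ∈ I) (μ : Fin 4) :
    HasDerivAt (fun ℓ ↦ c ℓ μ) (deriv c ℓ μ) ℓ :=
  hasDerivAt_pi.mp ((h.contDiffAt hℓ).differentiableAt (by simp)).hasDerivAt μ

theorem hasDerivAt_deriv_apply (h : IsGeodesicOn M Q lam c I) {ℓ : ℝ} (hℓ : ℓ ∈ I) (μ : Fin 4) :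
    HasDerivAt (fun ℓ ↦ deriv c ℓ μ) (deriv (deriv c) ℓ μ) ℓ := by
  have h2 : ContDiffOn ℝ ∞ (deriv c) I := h.smooth.deriv_of_isOpen h.isOpen (by simp)
  exact hasDerivAt_pi.mp ((h2.contDiffAt (h.isOpen.mem_nhds hℓ)).differentiableAt
    (by simp)).hasDerivAt μ

/-- The geodesic equation with the index lowered. -/
theorem lowered_equation (h : IsGeodesicOn M Q lam c I) {ℓ : ℝ} (hℓ : ℓ ∈ I) (μ : Fin 4) :
    metric M Q lam (c ℓ) μ μ * deriv (deriv c) ℓ μ +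
      ∑ α : Fin 4, metricDeriv M Q lam (c ℓ) α μ * deriv c ℓ α * deriv c ℓ μ -
      1 / 2 * ∑ α : Fin 4, metricDeriv M Q lam (c ℓ) μ α * deriv c ℓ α ^ 2 = 0 := by
  have h1 := h.equation ℓ hℓ μ
  rw [geodesic_sum_eq (h.mem_domain ℓ hℓ)] at h1
  have h2 := metric_apply_self_ne_zero (h.mem_domain ℓ hℓ) μ
  have h3 := congrArg (metric M Q lam (c ℓ) μ μ * ·) h1
  simp only [mul_add, mul_inv_cancel_left₀ h2, mul_zero] at h3
  linear_combination h3

end IsGeodesicOn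

theorem momentum_eq (ℓ : ℝ) (μ : Fin 4) :
    momentum M Q lam c ℓ μ = metric M Q lam (c ℓ) μ μ * deriv c ℓ μ := by
  simp only [momentum]
  rw [metric_eq_diagonal]
  simp [Matrix.diagonal_apply]

theorem energy_eq (ℓ : ℝ) :
    energy M Q lam c ℓ = lapse M Q lam (c ℓ 1) * deriv c ℓ 0 := by
  simp [energy, momentum_eq, metric]

theorem angularMomentum_eq (hequat : IsEquatorialOn c I) {ℓ : ℝ} (hℓ : ℓ ∈ I) :
    angularMomentum M Q lam c ℓ = c ℓ 1 ^ 2 * deriv c ℓ 3 := by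
  simp [angularMomentum, momentum_eq, metric, hequat ℓ hℓ]

theorem deriv_colatitude (hgeo : IsGeodesicOn M Q lam c I) (hequat : IsEquatorialOn c I)
    {ℓ : ℝ} (hℓ : ℓ ∈ I) : deriv c ℓ 2 = 0 :=
  (hgeo.hasDerivAt_apply hℓ 2).unique ((hasDerivAt_const ℓ (Real.pi / 2)).congr_of_eventuallyEq
    (by filter_upwards [hgeo.isOpen.mem_nhds hℓ] with s hs using hequat s hs))

/-- The left-hand side is the derivative of Δṫ, whence conservation of energy. -/
theorem time_equation (hgeo : IsGeodesicOn M Q lam c I)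
    {ℓ : ℝ} (hℓ : ℓ ∈ I) :
    lapse M Q lam (c ℓ 1) * deriv (deriv c) ℓ 0 +
      lapseDeriv M Q lam (c ℓ 1) * deriv c ℓ 1 * deriv c ℓ 0 = 0 := by
  have h := hgeo.lowered_equation hℓ 0
  simp [Fin.sum_univ_four, metric, metricDeriv] at h
  linear_combination -h

/-- The left-hand side is the derivative of r²φ̇, whence conservation of angular momentum. -/
theorem angle_equation (hgeo : IsGeodesicOn M Q lam c I) (hequat : IsEquatorialOn c I)
    {ℓ : ℝ} (hℓ : ℓ ∈ I) :
    c ℓ 1 ^ 2 * deriv (deriv c) ℓ 3 + 2 * c ℓ 1 * deriv c ℓ 1 * deriv c ℓ 3 = 0 := by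
  have h := hgeo.lowered_equation hℓ 3
  simp [Fin.sum_univ_four, metric, metricDeriv, hequat ℓ hℓ] at h
  linear_combination h

theorem radial_equation (hgeo : IsGeodesicOn M Q lam c I) (hequat : IsEquatorialOn c I)
    {ℓ : ℝ} (hℓ : ℓ ∈ I) :
    (lapse M Q lam (c ℓ 1))⁻¹ * deriv (deriv c) ℓ 1 -
      lapseDeriv M Q lam (c ℓ 1) / lapse M Q lam (c ℓ 1) ^ 2 * deriv c ℓ 1 ^ 2 / 2 +
      lapseDeriv M Q lam (c ℓ 1) * deriv c ℓ 0 ^ 2 / 2 - c ℓ 1 * deriv c ℓ 3 ^ 2 = 0 := by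
  have h := hgeo.lowered_equation hℓ 1
  have h2 := deriv_colatitude hgeo hequat hℓ
  simp [Fin.sum_univ_four, metric, metricDeriv, hequat ℓ hℓ, h2] at h
  linear_combination h

theorem null_equation (hgeo : IsGeodesicOn M Q lam c I) (hequat : IsEquatorialOn c I)
    (hnull : IsNullOn M Q lam c I) {ℓ : ℝ} (hℓ : ℓ ∈ I) :
    -lapse M Q lam (c ℓ 1) * deriv c ℓ 0 ^ 2 +
      (lapse M Q lam (c ℓ 1))⁻¹ * deriv c ℓ 1 ^ 2 + c ℓ 1 ^ 2 * deriv c ℓ 3 ^ 2 = 0 := by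
  have h := hnull ℓ hℓ
  have h2 := deriv_colatitude hgeo hequat hℓ
  simp [Fin.sum_univ_four, metric, Matrix.diagonal_apply, hequat ℓ hℓ, h2] at h
  linear_combination h

theorem energy_eqOn (hgeo : IsGeodesicOn M Q lam c I)
    {ℓ₀ : ℝ} (hℓ₀ : ℓ₀ ∈ I) {ℓ : ℝ} (hℓ : ℓ ∈ I) :
    lapse M Q lam (c ℓ 1) * deriv c ℓ 0 = energy M Q lam c ℓ₀ := by
  have hd (ℓ : ℝ) (hℓ : ℓ ∈ I) :
      HasDerivAt (fun ℓ ↦ lapse M Q lam (c ℓ 1) * deriv c ℓ 0) 0 ℓ := by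
    have h1 := (hasDerivAt_lapse (M := M) (Q := Q) (lam := lam)
      (hgeo.mem_domain ℓ hℓ).1).comp ℓ (hgeo.hasDerivAt_apply hℓ 1)
    refine (h1.mul (hgeo.hasDerivAt_deriv_apply hℓ 0)).congr_deriv ?_
    have := time_equation hgeo hℓ
    simp only [Function.comp_apply]
    linear_combination this
  rw [energy_eq]
  exact hgeo.isOpen.is_const_of_deriv_eq_zero hgeo.ordConnected.isPreconnected
    (fun ℓ hℓ ↦ (hd ℓ hℓ).differentiableAt.differentiableWithinAt)
    (fun ℓ hℓ ↦ (hd ℓ hℓ).deriv) hℓ hℓ₀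

theorem angularMomentum_eqOn (hgeo : IsGeodesicOn M Q lam c I) (hequat : IsEquatorialOn c I)
    {ℓ₀ : ℝ} (hℓ₀ : ℓ₀ ∈ I) {ℓ : ℝ} (hℓ : ℓ ∈ I) :
    c ℓ 1 ^ 2 * deriv c ℓ 3 = angularMomentum M Q lam c ℓ₀ := by
  have hd (ℓ : ℝ) (hℓ : ℓ ∈ I) : HasDerivAt (fun ℓ ↦ c ℓ 1 ^ 2 * deriv c ℓ 3) 0 ℓ := by
    refine (((hgeo.hasDerivAt_apply hℓ 1).pow 2).mul
      (hgeo.hasDerivAt_deriv_apply hℓ 3)).congr_deriv ?_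
    have := angle_equation hgeo hequat hℓ
    simp only [Pi.pow_apply]
    push_cast
    linear_combination this
  rw [angularMomentum_eq hequat hℓ₀]
  exact hgeo.isOpen.is_const_of_deriv_eq_zero hgeo.ordConnected.isPreconnected
    (fun ℓ hℓ ↦ (hd ℓ hℓ).differentiableAt.differentiableWithinAt)
    (fun ℓ hℓ ↦ (hd ℓ hℓ).deriv) hℓ hℓ₀

end RNdS

/-! ### The angle as parameter and the polar equations of motion -/

namespace RNdS

/-- The inverse function theorem along an interval. -/
theorem diffeo_of_deriv_ne_zero {f : ℝ → ℝ} {I : Set ℝ} (hI : IsOpen I) (hconn : I.OrdConnected)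
    (hf : ContDiffOn ℝ ∞ f I) (hne : ∀ ℓ ∈ I, deriv f ℓ ≠ 0) :
    IsDiffeoOntoImage f I ∧
      ∀ ℓ ∈ I, HasDerivAt (Function.invFunOn f I) (deriv f ℓ)⁻¹ (f ℓ) := by
  have hat {ℓ : ℝ} (hℓ : ℓ ∈ I) : ContDiffAt ℝ ∞ f ℓ := hf.contDiffAt (hI.mem_nhds hℓ)
  have hrolle {a b : ℝ} (ha : a ∈ I) (hb : b ∈ I) (hlt : a < b) : f a ≠ f b := by
    intro hab
    have hsub : Icc a b ⊆ I := hconn.out ha hb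
    obtain ⟨x, hx, hx0⟩ := exists_deriv_eq_zero hlt (hf.continuousOn.mono hsub) hab
    exact hne x (hsub (Ioo_subset_Icc_self hx)) hx0
  have hinj : InjOn f I := by
    intro a ha b hb hab
    rcases lt_trichotomy a b with h | h | h
    · exact absurd hab (hrolle ha hb h)
    · exact h
    · exact absurd hab.symm (hrolle hb ha h)
  have hlocal (ℓ : ℝ) (hℓ : ℓ ∈ I) : f '' I ∈ 𝓝 (f ℓ) ∧
      ContDiffAt ℝ ∞ (Function.invFunOn f I) (f ℓ) := by
    have hd := ((hat hℓ).differentiableAt (by simp)).hasDerivAt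
    have hF : HasFDerivAt f
        ((ContinuousLinearEquiv.unitsEquivAut ℝ (Units.mk0 _ (hne ℓ hℓ)) : ℝ ≃L[ℝ] ℝ) :
          ℝ →L[ℝ] ℝ) ℓ := by
      refine hd.hasFDerivAt.congr_fderiv ?_
      ext
      simp
    have hS := (hat hℓ).hasStrictFDerivAt' hF (by simp)
    have hg := (hat hℓ).to_localInverse hF (by simp)
    have hcont : Tendsto ((hat hℓ).localInverse hF (by simp)) (𝓝 (f ℓ)) (𝓝 ℓ) := by
      have := hg.continuousAt.tendsto
      rwa [ContDiffAt.localInverse_apply_image] at this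
    have hright : ∀ᶠ y in 𝓝 (f ℓ), f ((hat hℓ).localInverse hF (by simp) y) = y :=
      hS.eventually_right_inverse
    have hmem := hcont.eventually (hI.mem_nhds hℓ)
    refine ⟨?_, hg.congr_of_eventuallyEq ?_⟩
    · filter_upwards [hright, hmem] with y hy hyI using ⟨_, hyI, hy⟩
    · filter_upwards [hright, hmem] with y hy hyI
      have hex : ∃ x ∈ I, f x = y := ⟨_, hyI, hy⟩
      exact hinj (Function.invFunOn_mem hex) hyI ((Function.invFunOn_eq hex).trans hy.symm)
  refine ⟨⟨hf, hinj, ?_, ?_⟩, fun ℓ hℓ ↦ ?_⟩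
  · rw [isOpen_iff_mem_nhds]
    rintro _ ⟨ℓ, hℓ, rfl⟩
    exact (hlocal ℓ hℓ).1
  · rintro _ ⟨ℓ, hℓ, rfl⟩
    exact (hlocal ℓ hℓ).2.contDiffWithinAt
  · have hd := ((hat hℓ).differentiableAt (by simp)).hasDerivAt
    have hinv : Function.invFunOn f I (f ℓ) = ℓ := hinj.leftInvOn_invFunOn hℓ
    refine HasDerivAt.of_local_left_inverse (f := f) (hlocal ℓ hℓ).2.continuousAt
      (by rwa [hinv]) (hne ℓ hℓ) ?_
    filter_upwards [(hlocal ℓ hℓ).1] with y hy using Function.invFunOn_eq hy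

variable {M Q lam : ℝ} {c : ℝ → Coord} {I : Set ℝ}

theorem radial_speed (hgeo : IsGeodesicOn M Q lam c I) (hequat : IsEquatorialOn c I)
    (hnull : IsNullOn M Q lam c I) {ℓ₀ : ℝ} (hℓ₀ : ℓ₀ ∈ I) {ℓ : ℝ} (hℓ : ℓ ∈ I) :
    deriv c ℓ 1 ^ 2 = energy M Q lam c ℓ₀ ^ 2 -
      lapse M Q lam (c ℓ 1) * c ℓ 1 ^ 2 * deriv c ℓ 3 ^ 2 := by
  have h := null_equation hgeo hequat hnull hℓ
  have hΔ := (hgeo.mem_domain ℓ hℓ).2.1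
  rw [← energy_eqOn hgeo hℓ₀ hℓ]
  field_simp at h
  linear_combination h

/-- Nullity eliminates ṙ² and ṫ² together from the radial equation. Differentiating `radial_speed`
would give this only after division by ṙ, hence not at turning points. -/
theorem radial_acceleration (hgeo : IsGeodesicOn M Q lam c I) (hequat : IsEquatorialOn c I)
    (hnull : IsNullOn M Q lam c I) {ℓ : ℝ} (hℓ : ℓ ∈ I) :
    deriv (deriv c) ℓ 1 = deriv c ℓ 3 ^ 2 * (c ℓ 1 * lapse M Q lam (c ℓ 1) -
      c ℓ 1 ^ 2 * lapseDeriv M Q lam (c ℓ 1) / 2) := by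
  have h := null_equation hgeo hequat hnull hℓ
  have h1 := radial_equation hgeo hequat hℓ
  have hΔ := (hgeo.mem_domain ℓ hℓ).2.1
  field_simp at h h1
  have h2 : lapse M Q lam (c ℓ 1) * (2 * deriv (deriv c) ℓ 1) = lapse M Q lam (c ℓ 1) *
      (2 * (deriv c ℓ 3 ^ 2 * (c ℓ 1 * lapse M Q lam (c ℓ 1) -
      c ℓ 1 ^ 2 * lapseDeriv M Q lam (c ℓ 1) / 2))) := by
    linear_combination h1 + lapseDeriv M Q lam (c ℓ 1) * h
  have := mul_left_cancel₀ hΔ h2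
  linear_combination this / 2

theorem angularMomentum_ne_zero (hgeo : IsGeodesicOn M Q lam c I) (hequat : IsEquatorialOn c I)
    (hrad : ¬ IsRadialOn c I) {ℓ₀ : ℝ} (hℓ₀ : ℓ₀ ∈ I) : angularMomentum M Q lam c ℓ₀ ≠ 0 := by
  intro hL
  refine hrad ⟨c ℓ₀ 3, fun ℓ hℓ ↦ ?_⟩
  have hd (ℓ : ℝ) (hℓ : ℓ ∈ I) : HasDerivAt (fun ℓ ↦ c ℓ 3) 0 ℓ := by
    have h := angularMomentum_eqOn hgeo hequat hℓ₀ hℓ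
    rw [hL, mul_eq_zero_iff_left (pow_ne_zero 2 (hgeo.mem_domain ℓ hℓ).1)] at h
    exact (hgeo.hasDerivAt_apply hℓ 3).congr_deriv h
  exact hgeo.isOpen.is_const_of_deriv_eq_zero hgeo.ordConnected.isPreconnected
    (fun ℓ hℓ ↦ (hd ℓ hℓ).differentiableAt.differentiableWithinAt)
    (fun ℓ hℓ ↦ (hd ℓ hℓ).deriv) hℓ hℓ₀

theorem deriv_angle (hgeo : IsGeodesicOn M Q lam c I) (hequat : IsEquatorialOn c I)
    {ℓ₀ : ℝ} (hℓ₀ : ℓ₀ ∈ I) {ℓ : ℝ} (hℓ : ℓ ∈ I) :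
    deriv (fun ℓ ↦ c ℓ 3) ℓ = angularMomentum M Q lam c ℓ₀ / c ℓ 1 ^ 2 := by
  rw [(hgeo.hasDerivAt_apply hℓ 3).deriv, ← angularMomentum_eqOn hgeo hequat hℓ₀ hℓ,
    mul_div_cancel_left₀ _ (pow_ne_zero 2 (hgeo.mem_domain ℓ hℓ).1)]

theorem angle_diffeo (hgeo : IsGeodesicOn M Q lam c I) (hequat : IsEquatorialOn c I)
    (hrad : ¬ IsRadialOn c I) {ℓ₀ : ℝ} (hℓ₀ : ℓ₀ ∈ I) :
    IsDiffeoOntoImage (fun ℓ ↦ c ℓ 3) I ∧ ∀ ℓ ∈ I,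
      HasDerivAt (Function.invFunOn (fun ℓ ↦ c ℓ 3) I)
        (c ℓ 1 ^ 2 / angularMomentum M Q lam c ℓ₀) (c ℓ 3) := by
  have h := diffeo_of_deriv_ne_zero (f := fun ℓ ↦ c ℓ 3) hgeo.isOpen hgeo.ordConnected
    (contDiffOn_pi.mp hgeo.smooth 3) fun ℓ hℓ ↦ by
      rw [deriv_angle hgeo hequat hℓ₀ hℓ]
      exact div_ne_zero (angularMomentum_ne_zero hgeo hequat hrad hℓ₀)
        (pow_ne_zero 2 (hgeo.mem_domain ℓ hℓ).1)
  refine ⟨h.1, fun ℓ hℓ ↦ (h.2 ℓ hℓ).congr_deriv ?_⟩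
  rw [deriv_angle hgeo hequat hℓ₀ hℓ, inv_div]

/-- The first and second order equations of the polar radial motion. -/
theorem exists_polar_motion (hgeo : IsGeodesicOn M Q lam c I) (hequat : IsEquatorialOn c I)
    (hnull : IsNullOn M Q lam c I) (hrad : ¬ IsRadialOn c I) {ℓ₀ : ℝ} (hℓ₀ : ℓ₀ ∈ I)
    {δ : ℝ} (hδ : δ = lam + energy M Q lam c ℓ₀ ^ 2 / angularMomentum M Q lam c ℓ₀ ^ 2) :
    ∃ ρ' : ℝ → ℝ, ∀ φ ∈ angleRange c I,
      HasDerivAt (polarRadius c I) (ρ' φ) φ ∧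
      HasDerivAt ρ' (2 * δ * polarRadius c I φ ^ 3 - polarRadius c I φ + M) φ ∧
      ρ' φ ^ 2 = δ * polarRadius c I φ ^ 4 - polarRadius c I φ ^ 2 +
        2 * M * polarRadius c I φ - Q ^ 2 := by
  have hL := angularMomentum_ne_zero hgeo hequat hrad hℓ₀
  obtain ⟨hdiff, hinv⟩ := angle_diffeo hgeo hequat hrad hℓ₀
  set L := angularMomentum M Q lam c ℓ₀
  set E := energy M Q lam c ℓ₀
  set τ := Function.invFunOn (fun ℓ ↦ c ℓ 3) I
  -- The chain rule dr/dφ = ṙ · dℓ/dφ with dℓ/dφ = r²/L.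
  refine ⟨fun φ ↦ deriv c (τ φ) 1 * polarRadius c I φ ^ 2 / L, ?_⟩
  rintro _ ⟨ℓ, hℓ, rfl⟩
  have hτ : τ (c ℓ 3) = ℓ := hdiff.2.1.leftInvOn_invFunOn hℓ
  have hρ : polarRadius c I (c ℓ 3) = c ℓ 1 := congrArg (c · 1) hτ
  have hr := (hgeo.mem_domain ℓ hℓ).1
  have hspeed : deriv c ℓ 1 ^ 2 = E ^ 2 - lapse M Q lam (c ℓ 1) * c ℓ 1 ^ 2 * deriv c ℓ 3 ^ 2 :=
    radial_speed hgeo hequat hnull hℓ₀ hℓ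
  have hacc := radial_acceleration hgeo hequat hnull hℓ
  have hangle : deriv c ℓ 3 = L / c ℓ 1 ^ 2 := by
    rw [← (hgeo.hasDerivAt_apply hℓ 3).deriv, deriv_angle hgeo hequat hℓ₀ hℓ]
  have h1 : HasDerivAt (polarRadius c I) (deriv c ℓ 1 * (c ℓ 1 ^ 2 / L)) (c ℓ 3) :=
    HasDerivAt.comp (h₂ := fun ℓ ↦ c ℓ 1) (h := τ) (c ℓ 3)
      (by rw [hτ]; exact hgeo.hasDerivAt_apply hℓ 1) (hinv ℓ hℓ)
  have h2 : HasDerivAt (fun φ ↦ deriv c (τ φ) 1) (deriv (deriv c) ℓ 1 * (c ℓ 1 ^ 2 / L)) (c ℓ 3) :=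
    HasDerivAt.comp (h₂ := fun ℓ ↦ deriv c ℓ 1) (h := τ) (c ℓ 3)
      (by rw [hτ]; exact hgeo.hasDerivAt_deriv_apply hℓ 1) (hinv ℓ hℓ)
  have h3 := (h2.mul (h1.pow 2)).div_const L
  refine ⟨?_, ?_, ?_⟩
  · refine h1.congr_deriv ?_
    simp only [hτ, hρ, mul_div_assoc]
  · refine h3.congr_deriv ?_
    simp only [hτ, hρ, Pi.pow_apply]
    have e1 : deriv c ℓ 1 * (2 * c ℓ 1 * (deriv c ℓ 1 * (c ℓ 1 ^ 2 / L))) / L =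
        2 * c ℓ 1 ^ 3 * deriv c ℓ 1 ^ 2 / L ^ 2 := by
      field_simp
    push_cast
    rw [add_div, pow_one, e1, hspeed, hacc, hangle, hδ]
    simp only [lapse, lapseDeriv]
    field_simp
    ring
  · simp only [hτ, hρ]
    rw [div_pow, mul_pow, hspeed, hangle, hδ]
    simp only [lapse]
    field_simp
    ring

end RNdS

/-- Local uniqueness for autonomous second order equations. -/
theorem eventuallyEq_of_second_order_ode {V : Type*} [NormedAddCommGroup V] [NormedSpace ℝ V]
    {G : V → V} (hG : ContDiff ℝ 1 G) {x x' y y' : ℝ → V} {t₀ : ℝ}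
    (hx : ∀ᶠ t in 𝓝 t₀, HasDerivAt x (x' t) t ∧ HasDerivAt x' (G (x t)) t)
    (hy : ∀ᶠ t in 𝓝 t₀, HasDerivAt y (y' t) t ∧ HasDerivAt y' (G (y t)) t)
    (h0 : x t₀ = y t₀) (h1 : x' t₀ = y' t₀) : x =ᶠ[𝓝 t₀] y := by
  -- The equivalent first order system on V × V has a C¹, hence locally Lipschitz, field.
  have hv : ContDiff ℝ 1 fun p : V × V ↦ (p.2, G p.1) :=
    contDiff_snd.prodMk (hG.comp contDiff_fst)
  obtain ⟨K, s, hs, hK⟩ := (hv.contDiffAt (x := (x t₀, x' t₀))).exists_lipschitzOnWith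
  have hmem {x x' : ℝ → V} (hx : ∀ᶠ t in 𝓝 t₀, HasDerivAt x (x' t) t ∧ HasDerivAt x' (G (x t)) t)
      (hs : s ∈ 𝓝 (x t₀, x' t₀)) : ∀ᶠ t in 𝓝 t₀,
        HasDerivAt (fun t ↦ (x t, x' t)) (x' t, G (x t)) t ∧ (x t, x' t) ∈ s := by
    have hc : ContinuousAt (fun t ↦ (x t, x' t)) t₀ :=
      (hx.self_of_nhds.1.prodMk hx.self_of_nhds.2).continuousAt
    filter_upwards [hx, hc.tendsto.eventually hs] with t ht hts using ⟨ht.1.prodMk ht.2, hts⟩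
  have h := ODE_solution_unique_of_eventually (v := fun (_ : ℝ) (p : V × V) ↦ (p.2, G p.1))
    (f := fun t ↦ (x t, x' t)) (g := fun t ↦ (y t, y' t)) (s := fun _ ↦ s) (K := K)
    (Eventually.of_forall fun _ ↦ hK) (hmem hx hs)
    (hmem hy (h0 ▸ h1 ▸ hs)) (Prod.ext h0 h1)
  exact h.mono fun t ht ↦ congrArg Prod.fst ht

/-! ### Real solutions as translates of 1/(℘ - a) -/

namespace PeriodPair

variable {Λ : PeriodPair}

theorem tendsto_ofReal_add_nhdsNE (t : ℝ) (z : ℂ) :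
    Tendsto (fun s : ℝ ↦ (s : ℂ) + z) (𝓝[≠] t) (𝓝[≠] ((t : ℂ) + z)) := by
  refine tendsto_nhdsWithin_iff.mpr ⟨?_, ?_⟩
  · exact (by fun_prop : ContinuousAt (fun s : ℝ ↦ (s : ℂ) + z) t).tendsto.mono_left
      nhdsWithin_le_nhds
  · filter_upwards [self_mem_nhdsWithin] with s hs h
    exact hs (by simpa using h)

/-- Two phases for which the solutions agree on an interval differ by a period. -/
theorem sub_mem_lattice_of_invSub_eq {a z w : ℂ} {t : ℝ}
    (h : ∀ᶠ s : ℝ in 𝓝 t, Λ.invSub a (s + z) = Λ.invSub a (s + w)) : z - w ∈ Λ.lattice := by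
  have h1 : ∀ᶠ s : ℝ in 𝓝[≠] t, Λ.weierstrassP (s + z) = Λ.weierstrassP (s + w) := by
    filter_upwards [h.filter_mono nhdsWithin_le_nhds,
      (tendsto_ofReal_add_nhdsNE t z).eventually (Λ.eventually_notMem_lattice _),
      (tendsto_ofReal_add_nhdsNE t w).eventually (Λ.eventually_notMem_lattice _)] with s hs hz hw
    rw [invSub_of_notMem hz, invSub_of_notMem hw, inv_inj] at hs
    exact sub_left_injective hs
  have h2 : Tendsto (fun s : ℝ ↦ (s : ℂ)) (𝓝[≠] t) (𝓝[≠] (t : ℂ)) := by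
    simpa using tendsto_ofReal_add_nhdsNE t 0
  exact Λ.sub_mem_lattice_of_frequently_eq (h2.frequently h1.frequently)

/-- Surjectivity of ℘ realizes a nonzero u, the first order equation then fixes the derivative up to
sign, and w ↦ -w corrects the sign. The datum u = 0 forces u' = 0 and is realized at the lattice
point 0. -/
theorem exists_invSub_eq {a u u' : ℂ} (h : u' ^ 2 = 4 * u + 12 * a * u ^ 2 +
      (12 * a ^ 2 - Λ.g₂) * u ^ 3 + (4 * a ^ 3 - Λ.g₂ * a - Λ.g₃) * u ^ 4) :
    ∃ w, (w ∈ Λ.lattice ∨ Λ.weierstrassP w ≠ a) ∧ Λ.invSub a w = u ∧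
      deriv (Λ.invSub a) w = u' := by
  by_cases hu : u = 0
  · subst hu
    have h0 := Λ.lattice.zero_mem
    have hd := deriv_invSub_sq (analyticAt_invSub (a := a) (Or.inl h0))
    rw [invSub_of_mem h0] at hd
    refine ⟨0, Or.inl h0, invSub_of_mem h0, ?_⟩
    have h1 : deriv (Λ.invSub a) 0 = 0 := by simpa using hd
    have h2 : u' = 0 := by simpa using h
    rw [h1, h2]
  · obtain ⟨w, hw, hwa⟩ := Λ.exists_weierstrassP_eq (a + u⁻¹)
    have hne : Λ.weierstrassP w ≠ a := by rw [hwa]; simpa using hu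
    have hwu : Λ.invSub a w = u := by rw [invSub_of_notMem hw, hwa, add_sub_cancel_left, inv_inv]
    have hd := deriv_invSub_sq (analyticAt_invSub (Or.inr hne))
    rw [hwu, ← h] at hd
    rcases sq_eq_sq_iff_eq_or_eq_neg.mp hd with hd | hd
    · exact ⟨w, Or.inr hne, hwu, hd⟩
    · exact ⟨-w, Or.inr (by rwa [Λ.weierstrassP_neg]), by rw [invSub_neg, hwu],
        by rw [deriv_invSub_neg, hd, neg_neg]⟩

/-- The first order equation at t serves only to match the initial data; the second order equation,
read in ℂ, then forces agreement nearby. -/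
theorem exists_local_phase {a g2 g3 : ℝ} (hg2 : Λ.g₂ = g2) (hg3 : Λ.g₃ = g3) {u u' : ℝ → ℝ} {t : ℝ}
    (hode : ∀ᶠ s in 𝓝 t, HasDerivAt u (u' s) s ∧ HasDerivAt u' (2 + 12 * a * u s +
      3 / 2 * (12 * a ^ 2 - g2) * u s ^ 2 + 2 * (4 * a ^ 3 - g2 * a - g3) * u s ^ 3) s)
    (hsq : u' t ^ 2 = 4 * u t + 12 * a * u t ^ 2 + (12 * a ^ 2 - g2) * u t ^ 3 +
      (4 * a ^ 3 - g2 * a - g3) * u t ^ 4) :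
    ∃ z : ℂ, ((t : ℂ) + z ∈ Λ.lattice ∨ Λ.weierstrassP (t + z) ≠ a) ∧
      ∀ᶠ s : ℝ in 𝓝 t, (u s : ℂ) = Λ.invSub a (s + z) := by
  obtain ⟨w, hreg, hwu, hwu'⟩ := exists_invSub_eq (Λ := Λ) (a := a) (u := u t) (u' := u' t)
    (by rw [hg2, hg3]; exact_mod_cast hsq)
  have htw : (t : ℂ) + (w - t) = w := add_sub_cancel _ _
  refine ⟨w - t, by rwa [htw], ?_⟩
  have hG : ContDiff ℝ 1 fun v : ℂ ↦ 2 + 12 * (a : ℂ) * v +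
      3 / 2 * (12 * (a : ℂ) ^ 2 - Λ.g₂) * v ^ 2 +
      2 * (4 * (a : ℂ) ^ 3 - Λ.g₂ * a - Λ.g₃) * v ^ 3 := by fun_prop
  refine eventuallyEq_of_second_order_ode hG (x := fun s ↦ (u s : ℂ)) (x' := fun s ↦ (u' s : ℂ))
    (y := fun s : ℝ ↦ Λ.invSub a (s + (w - t)))
    (y' := fun s : ℝ ↦ deriv (Λ.invSub a) (s + (w - t))) ?_ ?_ ?_ ?_
  · filter_upwards [hode] with s hs
    refine ⟨hs.1.ofReal_comp, hs.2.ofReal_comp.congr_deriv ?_⟩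
    rw [hg2, hg3]
    push_cast
    ring
  · have hcont : Tendsto (fun s : ℝ ↦ (s : ℂ) + (w - t)) (𝓝 t) (𝓝 w) := by
      have : ContinuousAt (fun s : ℝ ↦ (s : ℂ) + (w - t)) t := by fun_prop
      simpa [ContinuousAt] using this
    filter_upwards [hcont.eventually (analyticAt_invSub hreg).eventually_analyticAt] with s hs
    refine ⟨(hs.differentiableAt.hasDerivAt.comp_add_const (s : ℂ) (w - t)).comp_ofReal, ?_⟩
    rw [← deriv_deriv_invSub hs]
    exact (hs.deriv.differentiableAt.hasDerivAt.comp_add_const (s : ℂ) (w - t)).comp_ofReal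
  · simp only [htw, hwu]
  · simp only [htw, hwu']

/-- The class of the local phase modulo the lattice is locally constant, hence constant on the
connected set J; periodicity allows a single representative. -/
theorem exists_phase {a g2 g3 : ℝ} (hg2 : Λ.g₂ = g2) (hg3 : Λ.g₃ = g3) {u u' : ℝ → ℝ} {J : Set ℝ}
    (hJ : IsOpen J) (hconn : IsPreconnected J)
    (hode : ∀ s ∈ J, HasDerivAt u (u' s) s ∧ HasDerivAt u' (2 + 12 * a * u s +
      3 / 2 * (12 * a ^ 2 - g2) * u s ^ 2 + 2 * (4 * a ^ 3 - g2 * a - g3) * u s ^ 3) s)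
    (hsq : ∀ t ∈ J, u' t ^ 2 = 4 * u t + 12 * a * u t ^ 2 + (12 * a ^ 2 - g2) * u t ^ 3 +
      (4 * a ^ 3 - g2 * a - g3) * u t ^ 4) :
    ∃ z : ℂ, ∀ t ∈ J, ((t : ℂ) + z ∈ Λ.lattice ∨ Λ.weierstrassP (t + z) ≠ a) ∧
      (u t : ℂ) = Λ.invSub a (t + z) := by
  have hlocal (t : ℝ) (ht : t ∈ J) := exists_local_phase hg2 hg3
    (eventually_of_mem (hJ.mem_nhds ht) hode) (hsq t ht)
  choose! z hreg hz using hlocal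
  have hP {s t : ℝ} (hs : s ∈ J) (ht : t ∈ J) : z s - z t ∈ Λ.lattice := by
    refine hconn.induction₂ (fun s t ↦ z s - z t ∈ Λ.lattice) (fun s hs ↦ ?_)
      (fun r s t _ _ _ h h' ↦ by simpa using add_mem h h')
      (fun s t _ _ h ↦ by simpa using neg_mem h) hs ht
    filter_upwards [(hz s hs).eventually_nhds.filter_mono nhdsWithin_le_nhds,
      self_mem_nhdsWithin] with t hst ht
    refine sub_mem_lattice_of_invSub_eq (a := a) (t := t) ?_
    filter_upwards [hst, hz t ht] with r h h'
    rw [← h, ← h']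
  rcases J.eq_empty_or_nonempty with rfl | ⟨s, hs⟩
  · exact ⟨0, by simp⟩
  refine ⟨z s, fun t ht ↦ ?_⟩
  have hl := hP ht hs
  have hsplit : (t : ℂ) + z t = t + z s + (z t - z s) := by ring
  have ht1 := hreg t ht
  have ht2 := (hz t ht).self_of_nhds
  rw [hsplit] at ht1 ht2
  refine ⟨ht1.imp (Λ.lattice.add_mem_iff_left hl).mp fun h ↦ ?_, ?_⟩
  · rwa [show (t : ℂ) + z s + (z t - z s) = t + z s + (⟨_, hl⟩ : Λ.lattice) from rfl,
      Λ.weierstrassP_add_coe] at h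
  · rw [ht2, invSub_add_of_mem hl]

end PeriodPair

/-! ### The quartic, its Weierstrass form and the polar motion -/

namespace RNdS

/-- The quartic of the polar motion has a real root as soon as it is nonnegative somewhere. -/
theorem exists_root_quartic {M Q δ r : ℝ}
    (hr : 0 ≤ δ * r ^ 4 - r ^ 2 + 2 * M * r - Q ^ 2) :
    ∃ x : ℝ, δ * x ^ 4 - x ^ 2 + 2 * M * x - Q ^ 2 = 0 := by
  have hcont : Continuous fun x : ℝ ↦ δ * x ^ 4 - x ^ 2 + 2 * M * x - Q ^ 2 := by fun_prop
  exact mem_range_of_exists_le_of_exists_ge hcont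
    ⟨0, by nlinarith [sq_nonneg Q]⟩ ⟨r, hr⟩

section Quartic

variable {M Q δ rbar α β γ g2 g3 : ℝ}

/-- Taylor expansion of the quartic of the polar motion at a root. -/
theorem quartic_eq_of_root (hroot : δ * rbar ^ 4 - rbar ^ 2 + 2 * M * rbar - Q ^ 2 = 0)
    (hγ : γ = 4 * rbar * δ) (hβ : β = 6 * rbar ^ 2 * δ - 1)
    (hα : α = 4 * rbar ^ 3 * δ - 2 * rbar + 2 * M) (r : ℝ) :
    δ * r ^ 4 - r ^ 2 + 2 * M * r - Q ^ 2 = α * (r - rbar) + β * (r - rbar) ^ 2 +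
      γ * (r - rbar) ^ 3 + δ * (r - rbar) ^ 4 := by
  rw [hα, hβ, hγ]
  linear_combination hroot

theorem halfDeriv_quartic_eq (hγ : γ = 4 * rbar * δ) (hβ : β = 6 * rbar ^ 2 * δ - 1)
    (hα : α = 4 * rbar ^ 3 * δ - 2 * rbar + 2 * M) (r : ℝ) :
    2 * δ * r ^ 3 - r + M = α / 2 + β * (r - rbar) + 3 / 2 * γ * (r - rbar) ^ 2 +
      2 * δ * (r - rbar) ^ 3 := by
  rw [hα, hβ, hγ]
  ring

/-- Dividing a quartic with root 0 by x⁴ makes it a cubic in 1/x; the factor α/4 normalizes the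
leading coefficient to 4 and the shift β/12 kills the quadratic term. -/
theorem weierstrass_sq_eq {x x' : ℝ} (hx : x ≠ 0)
    (hsq : x' ^ 2 = α * x + β * x ^ 2 + γ * x ^ 3 + δ * x ^ 4)
    (hg2 : g2 = 1 / 4 * (β ^ 2 / 3 - α * γ))
    (hg3 : g3 = 1 / 8 * (α * β * γ / 6 - α ^ 2 * δ / 2 - β ^ 3 / 27)) :
    (-(α * x') / (4 * x ^ 2)) ^ 2 =
      4 * (α / (4 * x) + β / 12) ^ 3 - g2 * (α / (4 * x) + β / 12) - g3 := by
  rw [div_pow, neg_sq, mul_pow, hsq, hg2, hg3]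
  field_simp
  ring

/-- For α = 0 the root is multiple, and g₂ = β²/12, g₃ = -β³/216 have zero discriminant. -/
theorem alpha_ne_zero_of_discriminant_ne_zero
    (hg2 : g2 = 1 / 4 * (β ^ 2 / 3 - α * γ))
    (hg3 : g3 = 1 / 8 * (α * β * γ / 6 - α ^ 2 * δ / 2 - β ^ 3 / 27))
    (h : g2 ^ 3 - 27 * g3 ^ 2 ≠ 0) : α ≠ 0 := by
  rintro rfl
  apply h
  rw [hg2, hg3]
  ring

end Quartic

section Motion

variable {M Q δ rbar α β γ g2 g3 : ℝ} {ρ ρ' : ℝ → ℝ} {J : Set ℝ}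

/-- A non-constant polar motion meets a root of its quartic only at isolated angles. -/
theorem eventually_ne_root (hJ : IsOpen J) (hconn : IsPreconnected J)
    (hρ : ∀ φ ∈ J, HasDerivAt ρ (ρ' φ) φ ∧ HasDerivAt ρ' (2 * δ * ρ φ ^ 3 - ρ φ + M) φ ∧
      ρ' φ ^ 2 = δ * ρ φ ^ 4 - ρ φ ^ 2 + 2 * M * ρ φ - Q ^ 2)
    (hroot : δ * rbar ^ 4 - rbar ^ 2 + 2 * M * rbar - Q ^ 2 = 0)
    (hnonconst : ∃ φ ∈ J, ρ φ ≠ rbar) {φ : ℝ} (hφ : φ ∈ J) :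
    ∀ᶠ ψ in 𝓝[≠] φ, ρ ψ ≠ rbar := by
  have hne {φ : ℝ} (hφ : φ ∈ J) (h : ρ φ ≠ rbar) : ∀ᶠ ψ in 𝓝 φ, ρ ψ ≠ rbar :=
    (hρ φ hφ).1.continuousAt.eventually_ne h
  have hzero {φ : ℝ} (hφ : φ ∈ J) (h : ρ φ = rbar) : ρ' φ = 0 := by
    have := (hρ φ hφ).2.2
    rw [h, hroot] at this
    exact pow_eq_zero_iff two_ne_zero |>.mp this
  by_cases h : ρ φ = rbar
  swap
  · exact (hne hφ h).filter_mono nhdsWithin_le_nhds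
  -- At a multiple root the constant r̄ solves the second order equation, so a motion that meets r̄
  -- stays there, first locally and then on all of J by connectedness.
  by_cases hα : 2 * δ * rbar ^ 3 - rbar + M = 0
  · exfalso
    obtain ⟨φ₁, hφ₁, h₁⟩ := hnonconst
    refine h₁ ((hconn.induction₂ (fun φ ψ ↦ ρ φ = rbar ↔ ρ ψ = rbar) (fun φ hφ ↦ ?_)
      (fun _ _ _ _ _ _ h h' ↦ h.trans h') (fun _ _ _ _ h ↦ h.symm) hφ hφ₁).mp h)
    refine Eventually.filter_mono nhdsWithin_le_nhds ?_
    by_cases h : ρ φ = rbar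
    · have huniq := eventuallyEq_of_second_order_ode (G := fun r ↦ 2 * δ * r ^ 3 - r + M)
        (by fun_prop) (x := ρ) (x' := ρ') (y := fun _ ↦ rbar) (y' := fun _ ↦ 0) (t₀ := φ)
        (eventually_of_mem (hJ.mem_nhds hφ) fun ψ hψ ↦ ⟨(hρ ψ hψ).1, (hρ ψ hψ).2.1⟩)
        (Eventually.of_forall fun ψ ↦ ⟨hasDerivAt_const ψ _, by
          rw [hα]
          exact hasDerivAt_const ψ _⟩) h (hzero hφ h)
      filter_upwards [huniq] with ψ hψ using iff_of_true h hψ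
    · filter_upwards [hne hφ h] with ψ hψ using iff_of_false h hψ
  -- At a simple root ρ'' ≠ 0, so φ is an isolated zero of ρ', and ρ' vanishes wherever ρ = r̄.
  · rw [← h] at hα
    filter_upwards [(hρ φ hφ).2.1.eventually_ne (c := 0) hα,
      mem_nhdsWithin_of_mem_nhds (hJ.mem_nhds hφ)] with ψ hψ hψJ hψr
    exact hψ (hzero hψJ hψr)

theorem polar_weierstrass_equation
    (hroot : δ * rbar ^ 4 - rbar ^ 2 + 2 * M * rbar - Q ^ 2 = 0)
    (hγ : γ = 4 * rbar * δ) (hβ : β = 6 * rbar ^ 2 * δ - 1)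
    (hα : α = 4 * rbar ^ 3 * δ - 2 * rbar + 2 * M)
    (hg2 : g2 = 1 / 4 * (β ^ 2 / 3 - α * γ))
    (hg3 : g3 = 1 / 8 * (α * β * γ / 6 - α ^ 2 * δ / 2 - β ^ 3 / 27)) {φ : ℝ}
    (hd : HasDerivAt ρ (ρ' φ) φ)
    (hsq : ρ' φ ^ 2 = δ * ρ φ ^ 4 - ρ φ ^ 2 + 2 * M * ρ φ - Q ^ 2) (hne : ρ φ ≠ rbar) :
    ∃ P' : ℝ, HasDerivAt (fun φ ↦ α / (4 * (ρ φ - rbar)) + β / 12) P' φ ∧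
      P' ^ 2 = 4 * (α / (4 * (ρ φ - rbar)) + β / 12) ^ 3 -
        g2 * (α / (4 * (ρ φ - rbar)) + β / 12) - g3 := by
  have hx := sub_ne_zero.mpr hne
  rw [quartic_eq_of_root hroot hγ hβ hα] at hsq
  refine ⟨_, ?_, weierstrass_sq_eq hx hsq hg2 hg3⟩
  refine (((hasDerivAt_const φ α).fun_div ((hd.sub_const rbar).const_mul 4)
    (mul_ne_zero four_ne_zero hx)).add_const (β / 12)).congr_deriv ?_
  field_simp
  ring

/-- Applies `PeriodPair.exists_phase` to u = 4(ρ - r̄)/α with a = β/12. Passages through r̄ are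
zeros of u, which correspond exactly to lattice points. -/
theorem exists_polar_phase (hJ : IsOpen J) (hconn : IsPreconnected J)
    (hρ : ∀ φ ∈ J, HasDerivAt ρ (ρ' φ) φ ∧ HasDerivAt ρ' (2 * δ * ρ φ ^ 3 - ρ φ + M) φ ∧
      ρ' φ ^ 2 = δ * ρ φ ^ 4 - ρ φ ^ 2 + 2 * M * ρ φ - Q ^ 2)
    (hroot : δ * rbar ^ 4 - rbar ^ 2 + 2 * M * rbar - Q ^ 2 = 0)
    (hγ : γ = 4 * rbar * δ) (hβ : β = 6 * rbar ^ 2 * δ - 1)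
    (hα : α = 4 * rbar ^ 3 * δ - 2 * rbar + 2 * M)
    (hg2 : g2 = 1 / 4 * (β ^ 2 / 3 - α * γ))
    (hg3 : g3 = 1 / 8 * (α * β * γ / 6 - α ^ 2 * δ / 2 - β ^ 3 / 27)) (hα0 : α ≠ 0)
    {Λ : PeriodPair} (hΛ2 : Λ.g₂ = g2) (hΛ3 : Λ.g₃ = g3) :
    ∃ z₀ : ℂ, ∀ φ ∈ J, (ρ φ = rbar ↔ (φ : ℂ) + z₀ ∈ Λ.lattice) ∧
      ((φ : ℂ) + z₀ ∉ Λ.lattice →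
        4 * Λ.weierstrassP ((φ : ℂ) + z₀) - (β : ℂ) / 3 ≠ 0 ∧
        (ρ φ : ℂ) = (rbar : ℂ) + (α : ℂ) /
          (4 * Λ.weierstrassP ((φ : ℂ) + z₀) - (β : ℂ) / 3)) := by
  obtain ⟨z, hz⟩ := PeriodPair.exists_phase (a := β / 12) hΛ2 hΛ3 hJ hconn
    (u := fun φ ↦ 4 / α * (ρ φ - rbar)) (u' := fun φ ↦ 4 / α * ρ' φ)
    (fun φ hφ ↦ ⟨((hρ φ hφ).1.sub_const rbar).const_mul _,
      ((hρ φ hφ).2.1.const_mul _).congr_deriv (by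
        rw [halfDeriv_quartic_eq hγ hβ hα, hg2, hg3]
        field_simp
        ring)⟩)
    (fun φ hφ ↦ by
      rw [mul_pow, (hρ φ hφ).2.2, quartic_eq_of_root hroot hγ hβ hα, hg2, hg3]
      field_simp
      ring)
  refine ⟨z, fun φ hφ ↦ ?_⟩
  obtain ⟨hreg, hu⟩ := hz φ hφ
  have hαC : (α : ℂ) ≠ 0 := by exact_mod_cast hα0
  push_cast at hreg hu
  have hr : (ρ φ : ℂ) = rbar + α / 4 * Λ.invSub (β / 12) (φ + z) := by
    rw [← hu]
    field_simp
    ring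
  have hfactor : 4 * Λ.weierstrassP (φ + z) - (β : ℂ) / 3 =
      4 * (Λ.weierstrassP (φ + z) - β / 12) := by ring
  have hsub (h : (φ : ℂ) + z ∉ Λ.lattice) : Λ.weierstrassP (φ + z) - (β : ℂ) / 12 ≠ 0 :=
    sub_ne_zero.mpr (hreg.resolve_left h)
  refine ⟨⟨fun h ↦ ?_, fun h ↦ ?_⟩, fun h ↦ ⟨?_, ?_⟩⟩
  · by_contra hmem
    rw [h, PeriodPair.invSub_of_notMem hmem] at hr
    exact mul_ne_zero (div_ne_zero hαC (by norm_num : (4 : ℂ) ≠ 0)) (inv_ne_zero (hsub hmem))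
      (by linear_combination -hr)
  · rw [PeriodPair.invSub_of_mem h, mul_zero, add_zero] at hr
    exact_mod_cast hr
  · rw [hfactor]
    exact mul_ne_zero (by norm_num) (hsub h)
  · rw [hr, PeriodPair.invSub_of_notMem h, hfactor]
    have := hsub h
    field_simp

end Motion

end RNdS

theorem proposition4p1 (M Q lam E L : ℝ) (c : ℝ → RNdS.Coord) (I : Set ℝ)
    (hgeo : RNdS.IsGeodesicOn M Q lam c I)
    (hnull : RNdS.IsNullOn M Q lam c I)
    (hequat : RNdS.IsEquatorialOn c I)
    (hcirc : ¬ RNdS.IsCircularOn c I)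
    (hrad : ¬ RNdS.IsRadialOn c I)
    (ℓ₀ : ℝ) (hℓ₀ : ℓ₀ ∈ I)
    (hE : RNdS.energy M Q lam c ℓ₀ = E)
    (hL : RNdS.angularMomentum M Q lam c ℓ₀ = L) :
    L ≠ 0 ∧ RNdS.IsDiffeoOntoImage (fun ℓ => c ℓ 3) I ∧
    (-(E ^ 2 / L ^ 2) ≤ lam →
      (∃ x : ℝ, (lam + E ^ 2 / L ^ 2) * x ^ 4 - x ^ 2 + 2 * M * x - Q ^ 2 = 0) ∧
      ∀ rbar : ℝ,
        (lam + E ^ 2 / L ^ 2) * rbar ^ 4 - rbar ^ 2 + 2 * M * rbar - Q ^ 2 = 0 →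
        ∀ α β γ δ g₂ g₃ : ℝ, ∀ P : ℝ → ℝ,
          δ = lam + E ^ 2 / L ^ 2 →
          γ = 4 * rbar * δ →
          β = 6 * rbar ^ 2 * δ - 1 →
          α = 4 * rbar ^ 3 * δ - 2 * rbar + 2 * M →
          g₂ = 1 / 4 * (β ^ 2 / 3 - α * γ) →
          g₃ = 1 / 8 * (α * β * γ / 6 - α ^ 2 * δ / 2 - β ^ 3 / 27) →
          (P = fun φ => α / (4 * (RNdS.polarRadius c I φ - rbar)) + β / 12) →
          -- the function `P` is defined on the angle range except at isolated points
          (∀ φ ∈ RNdS.angleRange c I,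
            ∀ᶠ ψ in 𝓝[≠] φ, RNdS.polarRadius c I ψ ≠ rbar) ∧
          -- the Weierstrass equation
          (∀ φ ∈ RNdS.angleRange c I, RNdS.polarRadius c I φ ≠ rbar →
            ∃ P' : ℝ, HasDerivAt P P' φ ∧ P' ^ 2 = 4 * P φ ^ 3 - g₂ * P φ - g₃) ∧
          -- the polar radial motion through the Weierstrass function of `(g₂, g₃)`
          (g₂ ^ 3 - 27 * g₃ ^ 2 ≠ 0 →
            (∃ Λ : PeriodPair, Λ.g₂ = (g₂ : ℂ) ∧ Λ.g₃ = (g₃ : ℂ)) ∧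
            ∀ Λ : PeriodPair, Λ.g₂ = (g₂ : ℂ) → Λ.g₃ = (g₃ : ℂ) →
              ∃ z₀ : ℂ, ∀ φ ∈ RNdS.angleRange c I,
                (RNdS.polarRadius c I φ = rbar ↔ (φ : ℂ) + z₀ ∈ Λ.lattice) ∧
                ((φ : ℂ) + z₀ ∉ Λ.lattice →
                  4 * Λ.weierstrassP ((φ : ℂ) + z₀) - (β : ℂ) / 3 ≠ 0 ∧
                  (RNdS.polarRadius c I φ : ℂ) =
                    (rbar : ℂ) + (α : ℂ) /
                      (4 * Λ.weierstrassP ((φ : ℂ) + z₀) - (β : ℂ) / 3)))) := by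

  have hL0 := RNdS.angularMomentum_ne_zero hgeo hequat hrad hℓ₀
  have hdiff := (RNdS.angle_diffeo hgeo hequat hrad hℓ₀).1
  refine ⟨hL ▸ hL0, hdiff, fun _ ↦ ?_⟩
  obtain ⟨ρ', hρ⟩ := RNdS.exists_polar_motion hgeo hequat hnull hrad hℓ₀ rfl
  rw [hE, hL] at hρ
  have hJ : IsOpen (RNdS.angleRange c I) := hdiff.2.2.1
  have hconn : IsPreconnected (RNdS.angleRange c I) :=
    hgeo.ordConnected.isPreconnected.image _ hdiff.1.continuousOn
  have hmem {ℓ : ℝ} (hℓ : ℓ ∈ I) : c ℓ 3 ∈ RNdS.angleRange c I := ⟨ℓ, hℓ, rfl⟩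
  -- On the orbit the quartic equals ρ'², which supplies a point where it is nonnegative.
  refine ⟨RNdS.exists_root_quartic ((hρ _ (hmem hℓ₀)).2.2 ▸ sq_nonneg _), ?_⟩
  intro rbar hroot α β γ δ g₂ g₃ P hδ hγ hβ hα hg₂ hg₃ hP
  rw [← hδ] at hroot hρ
  have hnonconst : ∃ φ ∈ RNdS.angleRange c I, RNdS.polarRadius c I φ ≠ rbar := by
    by_contra! h
    refine hcirc ⟨rbar, fun ℓ hℓ ↦ ?_⟩
    rw [← h _ (hmem hℓ)]
    exact congrArg (c · 1) (hdiff.2.1.leftInvOn_invFunOn hℓ).symm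
  refine ⟨fun φ hφ ↦ RNdS.eventually_ne_root hJ hconn hρ hroot hnonconst hφ,
    fun φ hφ hne ↦ ?_, fun hdisc ↦ ⟨?_, fun Λ hΛ2 hΛ3 ↦ ?_⟩⟩
  · rw [hP]
    exact RNdS.polar_weierstrass_equation hroot hγ hβ hα hg₂ hg₃ (hρ φ hφ).1 (hρ φ hφ).2.2 hne
  · exact PeriodPair.exists_invariants_eq _ _ (by exact_mod_cast hdisc)
  · exact RNdS.exists_polar_phase hJ hconn hρ hroot hγ hβ hα hg₂ hg₃
      (RNdS.alpha_ne_zero_of_discriminant_ne_zero hg₂ hg₃ hdisc) hΛ2 hΛ3
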